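/- \textbf{Theorem.} A halved monotone triangle with $n$ rows is an array of integers $(a_{i,j})_{1\le i\le n,\,1\le j\le\lceil i/2\rceil}$ with $a_{i+1,j}\le a_{i,j}$, $a_{i,j}\le a_{i+1,j+1}$ and $a_{i,j}<a_{i,j+1}$ whenever the entries involved exist. For integers $k_1<\dots<k_{\lceil n/2\rceil}\le x$ let $\gamma(n,x;k_1,\dots,k_{\lceil n/2\rceil})$ be the number of halved monotone triangles with $n$ rows, bottom row $(k_1,\dots,k_{\lceil n/2\rceil})$ and all entries at most $x$. Extend $\gamma$ to all integers $x,k_1,\dots,k_{\lceil n/2\rceil}$ as follows. Put $\sum_{i=a}^{b}f(i)=-\sum_{i=b+1}^{a-1}f(i)$ if $a>b$. For a function $a(l_1,\dots,l_{m-1})$ on $\mathbb Z^{m-1}$ and $(k_1,\dots,k_m)\in\mathbb Z^m$ define $\sum_{(l_1,\dots,l_{m-1})}^{(k_1,\dots,k_m)}a$ as the value of $a$ at the empty sequence if $m=1$, as $\sum_{l_1=k_1}^{k_2}a(l_1)$ if $m=2$, and for $m>2$ recursively as $$\sum_{(l_1,\dots,l_{m-2})}^{(k_1,\dots,k_{m-1})}\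 \sum_{l_{m-1}=k_{m-1}+1}^{k_m}a(l_1,\dots,l_{m-1})+\sum_{(l_1,\dots,l_{m-2})}^{(k_1,\dots,k_{m-2},k_{m-1}-1)}a(l_1,\dots,l_{m-2},k_{m-1}).$$ Let $\gamma(0,x;-)=1$, and let $\gamma(n,x;k_1,\dots,k_{\lceil n/2\rceil})$ be $$\sum_{(l_1,\dots,l_{n/2})}^{(k_1,\dots,k_{n/2},x)}\gamma(n-1,x;l_1,\dots,l_{n/2})\ \text{ if } n\ge 2 \text{ is even},\qquad \sum_{(l_1,\dots,l_{(n-1)/2})}^{(k_1,\dots,k_{(n+1)/2})}\gamma(n-1,x;l_1,\dots,l_{(n-1)/2})\ \text{ if } n \text{ is odd}.$$ On polynomials in $k_1,\dots,k_m$ over $\mathbb C$ let $E_{k_i}$ be the shift $k_i\mapsto k_i+1$ and $\Delta_{k_i}=E_{k_i}-\operatorname{id}$. For $p<q$ the operators $\operatorname{id}+E_{k_q}\Delta_{k_p}$ and $\operatorname{id}+E_{k_q}^{-1}\Delta_{k_p}$ are invertible on $\mathbb C[k_1,\dots,k_m]$; all these operators and their inverses commute. For all integers $x,k_1,\dots,k_{\lceil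 n/2\rceil}$ (and hence for the numbers of halved monotone triangles when $k_1<\dots<k_{\lceil n/2\rceil}\le x$) the following holds. If $n$ is odd then $$\gamma(n,x;k_1,\dots,k_{(n+1)/2})=\Bigl(\prod_{1\le p<q\le (n+1)/2}(\operatorname{id}+E_{k_q}\Delta_{k_p})^{-1}E_{k_p}(\operatorname{id}+E_{k_q}^{-1}\Delta_{k_p})^{-1}\Bigr)\prod_{1\le i<j\le (n+1)/2}\frac{(k_j-k_i)(2x+1-k_i-k_j)}{(j-i)(j+i-1)},$$ and if $n$ is even then $$\gamma(n,x;k_1,\dots,k_{n/2})=\Bigl(\prod_{1\le p<q\le n/2}(\operatorname{id}+E_{k_q}\Delta_{k_p})^{-1}E_{k_p}(\operatorname{id}+E_{k_q}^{-1}\Delta_{k_p})^{-1}\Bigr)\prod_{1\le i<j\le n/2}\frac{(k_j-k_i)(2x+2-k_i-k_j)}{(j-i)(j+i)}\ \prod_{i=1}^{n/2}\frac{x+1-k_i}{i}.$$ -/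

import Mathlib

namespace HalvedMonotone

/-! ### Halved monotone triangles -/

/-- Positions `(i, j)` (row, column) of a halved monotone triangle with `n` rows:
`1 ≤ i ≤ n` and `1 ≤ j ≤ ⌈i / 2⌉`. -/
abbrev Pos (n : ℕ) : Type :=
  {p : ℕ × ℕ // 1 ≤ p.1 ∧ p.1 ≤ n ∧ 1 ≤ p.2 ∧ p.2 ≤ (p.1 + 1) / 2}

/-- The row of a position. -/
def row {n : ℕ} (p : Pos n) : ℕ := p.1.1

/-- The column of a position. -/
def col {n : ℕ} (p : Pos n) : ℕ := p.1.2

/-- A triangular array `a` of integers is a halved monotone triangle if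
`a (i+1, j) ≤ a (i, j)`, `a (i, j) ≤ a (i+1, j+1)` and `a (i, j) < a (i, j+1)`
whenever both entries exist. -/
structure IsHalvedMonotoneTriangle {n : ℕ} (a : Pos n → ℤ) : Prop where
  northeast : ∀ p q : Pos n, row q = row p + 1 → col q = col p → a q ≤ a p
  southeast : ∀ p q : Pos n, row q = row p + 1 → col q = col p + 1 → a p ≤ a q
  strict : ∀ p q : Pos n, row q = row p → col q = col p + 1 → a p < a q

/-- The halved monotone triangles with `n` rows, no entry exceeding `x`, and bottom row
`(k_1, …, k_m)` (used with `m = ⌈n / 2⌉`; the index `j : Fin m` stands for `j + 1`). -/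
def triangles (n : ℕ) (x : ℤ) {m : ℕ} (k : Fin m → ℤ) : Set (Pos n → ℤ) :=
  {a | IsHalvedMonotoneTriangle a ∧ (∀ p, a p ≤ x) ∧
    ∀ (p : Pos n) (j : Fin m), row p = n → col p = (j : ℕ) + 1 → a p = k j}

/-! ### The function `γ` on arbitrary integer arguments -/

/-- The sum `∑_{i=a}^{b} f i`, with `∑_{i=a}^{b} f i = - ∑_{i=b+1}^{a-1} f i` if `a > b`. -/
noncomputable def extSum (a b : ℤ) (f : ℤ → ℤ) : ℤ :=
  if a ≤ b then ∑ i ∈ Finset.Icc a b, f i else -∑ i ∈ Finset.Icc (b + 1) (a - 1), f i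

/-- The summation operator `∑_{(l_1, …, l_m)}^{(k_1, …, k_{m+1})} a (l_1, …, l_m)` for arbitrary
`(k_1, …, k_{m+1}) ∈ ℤ^{m+1}`. For `m = 0` there is just the empty sequence to sum over. -/
noncomputable def sumOp : (m : ℕ) → (Fin (m + 1) → ℤ) → ((Fin m → ℤ) → ℤ) → ℤ
  | 0, _, a => a Fin.elim0
  | 1, k, a => extSum (k 0) (k 1) (fun l => a (fun _ => l))
  | m + 2, k, a =>
      let k' : Fin (m + 2) → ℤ := Fin.init k
      let u : ℤ := k' (Fin.last (m + 1))
      let k'' : Fin (m + 1) → ℤ := Fin.init k'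
      sumOp (m + 1) k' (fun l =>
          extSum (u + 1) (k (Fin.last (m + 2))) (fun t => a (Fin.snoc l t))) +
        sumOp (m + 1) (Fin.snoc k'' (u - 1)) (fun l => a (Fin.snoc l u))

/-- `gammaEven x m k = γ(2m, x; k_1, …, k_m)` for arbitrary integers `x, k_1, …, k_m`:
`γ(0, x; -) = 1`, and going from `2m` to `2m + 2` rows uses the recursion for an odd number of
rows (upper limits `l`) followed by the one for an even number of rows (upper limits
`k_1, …, k_{m+1}, x`). -/
noncomputable def gammaEven (x : ℤ) : (m : ℕ) → (Fin m → ℤ) → ℤ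
  | 0, _ => 1
  | m + 1, k => sumOp (m + 1) (Fin.snoc k x) (fun l => sumOp m l (gammaEven x m))

/-- `gammaOdd x m k = γ(2m+1, x; k_1, …, k_{m+1})` for arbitrary integers `x, k_1, …, k_{m+1}`. -/
noncomputable def gammaOdd (x : ℤ) (m : ℕ) (k : Fin (m + 1) → ℤ) : ℤ :=
  sumOp m k (gammaEven x m)

/-- The recursion for an even number of rows, `2m + 2`. -/
theorem gammaEven_succ (x : ℤ) (m : ℕ) (k : Fin (m + 1) → ℤ) :
    gammaEven x (m + 1) k = sumOp (m + 1) (Fin.snoc k x) (gammaOdd x m) := rfl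

/-! ### Operators on polynomials in `k_1, …, k_m` -/

/-- Linear operators on `ℂ[k_1, …, k_m]`. -/
abbrev Op (m : ℕ) : Type := Module.End ℂ (MvPolynomial (Fin m) ℂ)

/-- The substitution `k_i ↦ k_i + c`. -/
noncomputable def shiftHom {m : ℕ} (i : Fin m) (c : ℂ) : MvPolynomial (Fin m) ℂ →ₐ[ℂ] MvPolynomial (Fin m) ℂ :=
  MvPolynomial.aeval (Function.update MvPolynomial.X i (MvPolynomial.X i + MvPolynomial.C c))

theorem shiftHom_comm {m : ℕ} (i j : Fin m) (c d : ℂ) :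
    (shiftHom i c).comp (shiftHom j d) = (shiftHom j d).comp (shiftHom i c) := by
  ext1 l
  by_cases hi : l = i <;> by_cases hj : l = j <;> by_cases hij : i = j <;>
    simp_all [shiftHom, MvPolynomial.algebraMap_eq, add_right_comm]

theorem shiftHom_comp_neg {m : ℕ} (i : Fin m) (c : ℂ) :
    (shiftHom i c).comp (shiftHom i (-c)) = AlgHom.id ℂ _ := by
  ext1 l
  by_cases hi : l = i <;>
    simp_all [shiftHom, MvPolynomial.algebraMap_eq]

/-- The shift operator `E_{k_i}`, together with its inverse (the shift by `-1`). -/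
noncomputable def E {m : ℕ} (i : Fin m) : (Op m)ˣ where
  val := (shiftHom i 1).toLinearMap
  inv := (shiftHom i (-1)).toLinearMap
  val_inv := by
    refine LinearMap.ext fun f => ?_
    exact DFunLike.congr_fun (shiftHom_comp_neg i 1) f
  inv_val := by
    refine LinearMap.ext fun f => ?_
    have h := DFunLike.congr_fun (shiftHom_comp_neg i (-1)) f
    rw [neg_neg] at h
    exact h

/-- The difference operator `Δ_{k_i} = E_{k_i} - id`. -/
noncomputable def Delta {m : ℕ} (i : Fin m) : Op m := (E i : Op m) - 1

/-- `id + E_{k_q} Δ_{k_p}`. -/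
noncomputable def opA {m : ℕ} (p q : Fin m) : Op m := 1 + (E q : Op m) * Delta p

/-- `id + E_{k_q}⁻¹ Δ_{k_p}`. -/
noncomputable def opB {m : ℕ} (p q : Fin m) : Op m := 1 + ((E q)⁻¹ : (Op m)ˣ) * Delta p

/-- `(id + E_{k_q} Δ_{k_p})⁻¹ E_{k_p} (id + E_{k_q}⁻¹ Δ_{k_p})⁻¹`. Here `Ring.inverse` is the
two-sided inverse in the ring of linear operators, provided that it exists. -/
noncomputable def factor {m : ℕ} (p q : Fin m) : Op m :=
  Ring.inverse (opA p q) * (E p : Op m) * Ring.inverse (opB p q)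

theorem E_commute {m : ℕ} (i j : Fin m) : Commute (E i : Op m) (E j : Op m) := by
  refine LinearMap.ext fun f => ?_
  exact DFunLike.congr_fun (shiftHom_comm i j 1 1) f

theorem commute_inverse {m : ℕ} {T A : Op m} (h : Commute T A) : Commute T (Ring.inverse A) := by
  by_cases hA : IsUnit A
  · obtain ⟨u, rfl⟩ := hA
    rw [Ring.inverse_unit]
    exact h.units_inv_right
  · rw [Ring.inverse_non_unit _ hA]
    exact Commute.zero_right T

/-- An operator commuting with all shifts commutes with each `factor p q`. -/
theorem commute_factor {m : ℕ} {T : Op m} (h : ∀ i : Fin m, Commute T (E i : Op m)) (p q : Fin m) :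
    Commute T (factor p q) := by
  have hD : Commute T (Delta p) := (h p).sub_right (Commute.one_right T)
  have hA : Commute T (opA p q) := (Commute.one_right T).add_right ((h q).mul_right hD)
  have hB : Commute T (opB p q) :=
    (Commute.one_right T).add_right (((h q).units_inv_right).mul_right hD)
  exact ((commute_inverse hA).mul_right (h p)).mul_right (commute_inverse hB)

theorem factor_commute {m : ℕ} (p q r s : Fin m) : Commute (factor p q) (factor r s) :=
  commute_factor (fun i => (commute_factor (fun j => E_commute i j) p q).symm) r s

/-- The composition of the (commuting) operators `factor p q` over `1 ≤ p < q ≤ m`. -/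
noncomputable def prodOp (m : ℕ) : Op m :=
  (Finset.univ.filter (fun s : Fin m × Fin m => s.1 < s.2)).noncommProd
    (fun s => factor s.1 s.2) (fun _ _ _ _ _ => factor_commute _ _ _ _)

/-! ### The explicit polynomials -/

/-- The index `i ∈ {1, …, m}` that corresponds to an element of `Fin m`. -/
noncomputable def idx {m : ℕ} (i : Fin m) : ℂ := ((i : ℕ) : ℂ) + 1

open MvPolynomial in
/-- `∏_{1 ≤ i < j ≤ m} (k_j - k_i) (2x + 1 - k_i - k_j) / ((j - i) (j + i - 1))`. -/
noncomputable def polyOdd (m : ℕ) (x : ℤ) : MvPolynomial (Fin m) ℂ :=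
  ∏ s ∈ Finset.univ.filter (fun s : Fin m × Fin m => s.1 < s.2),
    C (1 / ((idx s.2 - idx s.1) * (idx s.2 + idx s.1 - 1))) *
      ((X s.2 - X s.1) * (C (2 * (x : ℂ) + 1) - X s.1 - X s.2))

open MvPolynomial in
/-- `∏_{1 ≤ i < j ≤ m} (k_j - k_i) (2x + 2 - k_i - k_j) / ((j - i) (j + i))
  * ∏_{i = 1}^{m} (x + 1 - k_i) / i`. -/
noncomputable def polyEven (m : ℕ) (x : ℤ) : MvPolynomial (Fin m) ℂ :=
  (∏ s ∈ Finset.univ.filter (fun s : Fin m × Fin m => s.1 < s.2),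
    C (1 / ((idx s.2 - idx s.1) * (idx s.2 + idx s.1))) *
      ((X s.2 - X s.1) * (C (2 * (x : ℂ) + 2) - X s.1 - X s.2))) *
  ∏ i : Fin m, C (1 / idx i) * (C ((x : ℂ) + 1) - X i)

/-- The value of a polynomial at an integer point. -/
noncomputable def evalAt {m : ℕ} (k : Fin m → ℤ) (f : MvPolynomial (Fin m) ℂ) : ℂ :=
  MvPolynomial.eval (fun i => (k i : ℂ)) f

end HalvedMonotone

/-! Write `P_m` for the product operator (`prodOp m`, later `sProd m`). The proof is an induction
over the rows: each step of the recursion turns `P` applied to one explicit polynomial into `P`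
applied to the next.

Telescoping. Suppose that `a` is the iterated backward difference of `b` in all variables, and that
`b(t,t) - b(t-1,t) + b(t-1,t-1) = 0` in any two neighbouring arguments. Then the summation operator
applied to `a` is the alternating sum of the values `b(k_1-1, ..., k_{j-1}-1, k_{j+1}, ...,
k_{m+1})`, for all integer limits (`sumOp_eq_altSum`).

Three properties of `P` make this usable. (1) For neighbouring `i`, `j = i+1`, the operator `(1 -
E_i⁻¹ + E_i⁻¹ E_j⁻¹) P_m` is symmetric in `i` and `j`, so `b = P_m f` satisfies the condition above
whenever `f` is antisymmetric (`shiftVanishing_sProd`). (2) On polynomials free of `k_j`, `P_{m+1}`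
acts as `P_m` in the other variables times `E_p⁻¹` for all `p < j`. Hence the alternating sum of
`P_m f` is `P_{m+1}` applied to the alternating sum of copies of `f` with one variable omitted
(`altSum_sProd`). (3) `P_m` commutes with `k_m ↦ c - k_m`, because each factor is invariant under
`E_q ↔ E_q⁻¹`. If `f` is odd under `k_m ↦ 2x - k_m`, then `P_m f` vanishes at `k_m = x`, and with
last limit `x` only one term of the alternating sum survives (`altSum_sProd_snoc`).

Since `P` commutes with differences, only antisymmetric antidifferences of the explicit polynomials
remain to be found. In `u = x + 1 - k` these polynomials are determinants of factorial polynomials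
that are even about `1/2` or odd about `0`; the two families are exchanged by differencing. From an
even to an odd number of rows the alternating sum is a Laplace expansion; from odd to even the
surviving term is a shift.

Independently, for increasing `k` bounded by `x` the summation operator is an honest sum over
interlacing rows, so `γ` counts triangles. -/

namespace HalvedMonotone

/-! ### The summation operator on increasing sequences -/

/-- The strictly increasing integer sequences interlacing with `k`. -/
noncomputable def interlacing {m : ℕ} (k : Fin (m + 1) → ℤ) : Finset (Fin m → ℤ) :=
  open Classical in
  (Fintype.piFinset fun i : Fin m => Finset.Icc (k i.castSucc) (k i.succ)).filter StrictMono

theorem mem_interlacing {m : ℕ} {k : Fin (m + 1) → ℤ} {l : Fin m → ℤ} :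
    l ∈ interlacing k ↔ (∀ i : Fin m, k i.castSucc ≤ l i ∧ l i ≤ k i.succ) ∧ StrictMono l := by
  simp [interlacing]

theorem extSum_eq_sum {a b : ℤ} (h : a ≤ b + 1) (f : ℤ → ℤ) :
    extSum a b f = ∑ i ∈ Finset.Icc a b, f i := by
  unfold extSum
  split_ifs with hab
  · rfl
  · obtain rfl : a = b + 1 := by omega
    simp

theorem strictMono_snoc {m : ℕ} {l : Fin (m + 1) → ℤ} {t : ℤ} :
    StrictMono (Fin.snoc l t : Fin (m + 2) → ℤ) ↔ StrictMono l ∧ l (Fin.last m) < t := by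
  rw [Fin.strictMono_iff_lt_succ, Fin.forall_fin_succ', Fin.strictMono_iff_lt_succ]
  simp only [Fin.snoc_castSucc, Fin.succ_last, Fin.snoc_last, ← Fin.castSucc_succ]

theorem monotone_snoc {m : ℕ} {l : Fin (m + 1) → ℤ} {t : ℤ} :
    Monotone (Fin.snoc l t : Fin (m + 2) → ℤ) ↔ Monotone l ∧ l (Fin.last m) ≤ t := by
  rw [Fin.monotone_iff_le_succ, Fin.forall_fin_succ', Fin.monotone_iff_le_succ]
  simp only [Fin.snoc_castSucc, Fin.succ_last, Fin.snoc_last, ← Fin.castSucc_succ]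

theorem snoc_mem_interlacing {m : ℕ} {k : Fin (m + 2) → ℤ} {v t : ℤ} {l : Fin (m + 1) → ℤ} :
    (Fin.snoc l t : Fin (m + 2) → ℤ) ∈ interlacing (Fin.snoc k v : Fin (m + 3) → ℤ) ↔
      l ∈ interlacing k ∧ l (Fin.last m) < t ∧ k (Fin.last (m + 1)) ≤ t ∧ t ≤ v := by
  simp only [mem_interlacing, strictMono_snoc]
  rw [Fin.forall_fin_succ']
  simp only [Fin.snoc_castSucc, Fin.succ_last, Fin.snoc_last, ← Fin.castSucc_succ]
  tauto

theorem mem_interlacing_snoc_sub_one {m : ℕ} {k : Fin (m + 1) → ℤ} {u : ℤ}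
    {l : Fin (m + 1) → ℤ} :
    l ∈ interlacing (Fin.snoc k (u - 1) : Fin (m + 2) → ℤ) ↔
      l ∈ interlacing (Fin.snoc k u : Fin (m + 2) → ℤ) ∧ l (Fin.last m) < u := by
  simp only [mem_interlacing]
  rw [Fin.forall_fin_succ', Fin.forall_fin_succ']
  simp only [Fin.snoc_castSucc, Fin.succ_last, Fin.snoc_last, ← Fin.castSucc_succ]
  constructor
  · rintro ⟨⟨h1, h2, h3⟩, h4⟩
    exact ⟨⟨⟨h1, h2, by omega⟩, h4⟩, by omega⟩
  · rintro ⟨⟨⟨h1, h2, h3⟩, h4⟩, h5⟩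
    exact ⟨⟨h1, h2, by omega⟩, h4⟩

theorem last_le_of_mem_interlacing {m : ℕ} {k : Fin (m + 2) → ℤ} {l : Fin (m + 1) → ℤ}
    (h : l ∈ interlacing k) : l (Fin.last m) ≤ k (Fin.last (m + 1)) :=
  ((mem_interlacing.1 h).1 (Fin.last m)).2

/-- The recursion sorts the interlacing sequences by their last entry, relative to the second to
last limit `u`. An entry above `u` exceeds its predecessor automatically; an entry equal to `u`
forces the predecessor to be at most `u - 1`. Equality of the last two limits must be allowed, both
for `k_m = x` and for the limit `u - 1` in the induction. -/
theorem sumOp_eq_sum (m : ℕ) (k : Fin (m + 1) → ℤ) (a : (Fin m → ℤ) → ℤ)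
    (hk : StrictMono (Fin.init k)) (hk' : Monotone k) :
    sumOp m k a = ∑ l ∈ interlacing k, a l := by
  induction m using Nat.twoStepInduction with
  | zero =>
    have : interlacing k = {Fin.elim0} := by
      ext l
      simp only [mem_interlacing, Finset.mem_singleton, Subsingleton.elim l Fin.elim0, iff_true]
      exact ⟨fun i => i.elim0, fun i => i.elim0⟩
    rw [this, Finset.sum_singleton]; rfl
  | one =>
    have h01 : k 0 ≤ k 1 := hk' (Fin.zero_le _)
    rw [sumOp, extSum_eq_sum (by omega)]
    refine Finset.sum_bij' (fun t _ => fun _ => t) (fun l _ => l 0) ?_ ?_ ?_ ?_ ?_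
    · intro t ht
      rw [Finset.mem_Icc] at ht
      rw [mem_interlacing]
      exact ⟨fun i => by rw [Subsingleton.elim i 0]; exact ht, Subsingleton.strictMono _⟩
    · intro l hl
      exact Finset.mem_Icc.2 ((mem_interlacing.1 hl).1 0)
    · intro _ _; rfl
    · intro l _; ext i; rw [Subsingleton.elim i 0]
    · intro _ _; rfl
  | more m _ ih =>
    obtain ⟨k', v, rfl⟩ : ∃ k' v, k = Fin.snoc k' v := ⟨_, _, (Fin.snoc_init_self k).symm⟩
    obtain ⟨k'', u, rfl⟩ : ∃ k'' u, k' = Fin.snoc k'' u := ⟨_, _, (Fin.snoc_init_self k').symm⟩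
    simp only [sumOp, Fin.init_snoc, Fin.snoc_last] at hk ⊢
    rw [monotone_snoc, Fin.snoc_last] at hk'
    rw [strictMono_snoc] at hk
    rw [ih _ _ (by simpa using hk.1) hk'.1, ih _ _ (by simpa using hk.1)
      (monotone_snoc.2 ⟨hk.1.monotone, by omega⟩)]
    -- For `u = v` the range is empty, and the convention for reversed limits also gives `0`.
    simp only [extSum_eq_sum (show u + 1 ≤ v + 1 by omega)]
    rw [← Finset.sum_product', ← Finset.sum_filter_add_sum_filter_not
      (interlacing (Fin.snoc (Fin.snoc k'' u : Fin (m + 2) → ℤ) v : Fin (m + 3) → ℤ))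
      (fun l => u < l (Fin.last (m + 1)))]
    congr 1
    · refine Finset.sum_bij' (fun p _ => Fin.snoc p.1 p.2)
        (fun l _ => (Fin.init l, l (Fin.last (m + 1)))) ?_ ?_ ?_ ?_ ?_
      · rintro ⟨l, t⟩ h
        simp only [Finset.mem_product, Finset.mem_Icc] at h
        have := last_le_of_mem_interlacing h.1
        rw [Fin.snoc_last] at this
        simp only [Finset.mem_filter, snoc_mem_interlacing, Fin.snoc_last]
        exact ⟨⟨h.1, by omega, by omega, by omega⟩, by omega⟩
      · intro l h
        obtain ⟨l', t, rfl⟩ : ∃ l' t, l = Fin.snoc l' t := ⟨_, _, (Fin.snoc_init_self l).symm⟩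
        simp only [Finset.mem_filter, snoc_mem_interlacing, Fin.snoc_last] at h
        simp only [Finset.mem_product, Finset.mem_Icc, Fin.init_snoc, Fin.snoc_last]
        exact ⟨h.1.1, by omega, by omega⟩
      · simp
      · simp
      · simp
    · refine Finset.sum_bij' (fun l _ => Fin.snoc l u) (fun l _ => Fin.init l) ?_ ?_ ?_ ?_ ?_
      · intro l h
        rw [mem_interlacing_snoc_sub_one] at h
        simp only [Finset.mem_filter, snoc_mem_interlacing, Fin.snoc_last]
        exact ⟨⟨h.1, h.2, le_rfl, hk'.2⟩, lt_irrefl _⟩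
      · intro l h
        obtain ⟨l', t, rfl⟩ : ∃ l' t, l = Fin.snoc l' t := ⟨_, _, (Fin.snoc_init_self l).symm⟩
        simp only [Finset.mem_filter, snoc_mem_interlacing, Fin.snoc_last] at h
        rw [mem_interlacing_snoc_sub_one, Fin.init_snoc]
        exact ⟨h.1.1, by omega⟩
      · simp
      · intro l h
        obtain ⟨l', t, rfl⟩ : ∃ l' t, l = Fin.snoc l' t := ⟨_, _, (Fin.snoc_init_self l).symm⟩
        simp only [Finset.mem_filter, snoc_mem_interlacing, Fin.snoc_last] at h
        rw [Fin.init_snoc, show t = u by omega]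
      · simp

/-! ### Counting triangles by their second to last row -/

/-- The inclusion of the positions of the first `n` rows. -/
def inclPos {n : ℕ} (p : Pos n) : Pos (n + 1) := ⟨p.1, p.2.1, p.2.2.1.trans n.le_succ, p.2.2.2⟩

/-- A triangle with `n + 1` rows, composed of its first `n` rows and its bottom row. -/
def appendRow {n m : ℕ} (hm : m = (n + 2) / 2) (k : Fin m → ℤ) (b : Pos n → ℤ)
    (p : Pos (n + 1)) : ℤ :=
  if h : p.1.1 ≤ n then b ⟨p.1, p.2.1, h, p.2.2.2⟩
  else k ⟨p.1.2 - 1, by obtain ⟨⟨i, j⟩, h1, h2, h3, h4⟩ := p; simp only at *; omega⟩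

theorem appendRow_inclPos {n m : ℕ} (hm : m = (n + 2) / 2) (k : Fin m → ℤ) (b : Pos n → ℤ)
    (p : Pos n) : appendRow hm k b (inclPos p) = b p :=
  dif_pos p.2.2.1

theorem appendRow_bottom {n m : ℕ} (hm : m = (n + 2) / 2) (k : Fin m → ℤ) (b : Pos n → ℤ)
    (p : Pos (n + 1)) (j : Fin m) (hp : row p = n + 1) (hj : col p = j + 1) :
    appendRow hm k b p = k j := by
  rw [appendRow, dif_neg (by simp only [row] at hp; omega)]
  congr 1
  ext
  simp only [col] at hj
  simp [hj]

theorem pos_cases {n m : ℕ} (hm : m = (n + 2) / 2) (p : Pos (n + 1)) :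
    (∃ q : Pos n, p = inclPos q) ∨ (row p = n + 1 ∧ ∃ j : Fin m, col p = j + 1) := by
  obtain ⟨⟨i, j⟩, h1, h2, h3, h4⟩ := p
  simp only at h1 h2 h3 h4
  by_cases h : i ≤ n
  · exact Or.inl ⟨⟨(i, j), h1, h, h3, h4⟩, rfl⟩
  · obtain rfl : i = n + 1 := by omega
    exact Or.inr ⟨rfl, ⟨j - 1, by omega⟩, by simp [col]; omega⟩

theorem exists_pos {n m : ℕ} (hn : n ≠ 0) (hm : m = (n + 1) / 2) (j : Fin m) :
    ∃ p : Pos n, row p = n ∧ col p = j + 1 :=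
  ⟨⟨(n, j + 1), by omega, le_rfl, by omega, by have := j.2; simp only; omega⟩, rfl, rfl⟩

/-- The row `l` may stand directly above the row `k`. -/
def IsAbove {m r : ℕ} (k : Fin m → ℤ) (l : Fin r → ℤ) : Prop :=
  (∀ (i : Fin m) (j : Fin r), (i : ℕ) = j → k i ≤ l j) ∧
    ∀ (i : Fin m) (j : Fin r), (i : ℕ) = j + 1 → l j ≤ k i

theorem mem_triangles_succ {n m r : ℕ} (hm : m = (n + 2) / 2) (hr : r = (n + 1) / 2) {x : ℤ}
    {k : Fin m → ℤ} (hk : StrictMono k) (hx : ∀ i, k i ≤ x) {l : Fin r → ℤ} {b : Pos n → ℤ}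
    (hb : b ∈ triangles n x l) (hl : IsAbove k l) :
    appendRow hm k b ∈ triangles (n + 1) x k := by
  obtain ⟨⟨h1, h2, h3⟩, h4, h5⟩ := hb
  have hrow (p : Pos n) : row (inclPos p) = row p := rfl
  have hcol (p : Pos n) : col (inclPos p) = col p := rfl
  have hle (p : Pos n) : row p ≤ n := p.2.2.1
  have hc (p : Pos n) (hp : row p = n) : ∃ j : Fin r, col p = j + 1 := by
    obtain ⟨⟨i, j⟩, g1, g2, g3, g4⟩ := p
    simp only [row, col] at *
    exact ⟨⟨j - 1, by omega⟩, by simp; omega⟩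
  refine ⟨⟨?_, ?_, ?_⟩, ?_, ?_⟩
  · intro p q hpq hcc
    rcases pos_cases hm p with ⟨p, rfl⟩ | ⟨hp, i, hi⟩ <;>
      rcases pos_cases hm q with ⟨q, rfl⟩ | ⟨hq, j, hj⟩
    · rw [appendRow_inclPos, appendRow_inclPos]; exact h1 p q hpq hcc
    · rw [hrow] at hpq
      obtain ⟨i, hi⟩ := hc p (by omega)
      rw [appendRow_inclPos, appendRow_bottom hm k b q j hq hj, h5 p i (by omega) hi]
      exact hl.1 j i (by rw [hcol] at hcc; omega)
    · have := hle q; rw [hrow] at hpq; omega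
    · omega
  · intro p q hpq hcc
    rcases pos_cases hm p with ⟨p, rfl⟩ | ⟨hp, i, hi⟩ <;>
      rcases pos_cases hm q with ⟨q, rfl⟩ | ⟨hq, j, hj⟩
    · rw [appendRow_inclPos, appendRow_inclPos]; exact h2 p q hpq hcc
    · rw [hrow] at hpq
      obtain ⟨i, hi⟩ := hc p (by omega)
      rw [appendRow_inclPos, appendRow_bottom hm k b q j hq hj, h5 p i (by omega) hi]
      exact hl.2 j i (by rw [hcol] at hcc; omega)
    · have := hle q; rw [hrow] at hpq; omega
    · omega
  · intro p q hpq hcc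
    rcases pos_cases hm p with ⟨p, rfl⟩ | ⟨hp, i, hi⟩ <;>
      rcases pos_cases hm q with ⟨q, rfl⟩ | ⟨hq, j, hj⟩
    · rw [appendRow_inclPos, appendRow_inclPos]; exact h3 p q hpq hcc
    · have := hle p; rw [hrow] at hpq; omega
    · have := hle q; rw [hrow] at hpq; omega
    · rw [appendRow_bottom hm k b p i hp hi, appendRow_bottom hm k b q j hq hj]
      exact hk (Fin.lt_def.2 (by omega))
  · intro p
    rcases pos_cases hm p with ⟨p, rfl⟩ | ⟨hp, i, hi⟩
    · rw [appendRow_inclPos]; exact h4 p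
    · rw [appendRow_bottom hm k b p i hp hi]; exact hx i
  · exact fun p j => appendRow_bottom hm k b p j

theorem triangles_succ_eq {n m r : ℕ} (hm : m = (n + 2) / 2) (hr : r = (n + 1) / 2) {x : ℤ}
    {k : Fin m → ℤ} (hk : StrictMono k) (hx : ∀ i, k i ≤ x) (S : Finset (Fin r → ℤ))
    (hS : ∀ l, l ∈ S ↔ StrictMono l ∧ (∀ i, l i ≤ x) ∧ IsAbove k l) :
    triangles (n + 1) x k = appendRow hm k '' ⋃ l ∈ (S : Set (Fin r → ℤ)), triangles n x l := by
  ext a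
  simp only [Set.mem_image, Set.mem_iUnion, exists_prop, Finset.mem_coe]
  constructor
  · intro ha
    obtain ⟨⟨h1, h2, h3⟩, h4, h5⟩ := ha
    refine ⟨fun p => a (inclPos p), ⟨fun j => a ⟨(n, j + 1), ?_⟩, (hS _).2 ⟨?_, ?_, ?_, ?_⟩,
      ⟨?_, ?_, ?_⟩, ?_, ?_⟩, ?_⟩
    · have := j.2; simp only; omega
    · intro i j hij
      -- The definition compares adjacent columns only, so strictness is chained across the gap.
      obtain ⟨d, hd⟩ := Nat.exists_eq_add_of_lt (Fin.lt_def.1 hij)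
      clear hij
      induction d generalizing j with
      | zero => exact h3 _ _ rfl (by simp [col]; omega)
      | succ d ih =>
        exact (ih (j := ⟨i + d + 1, by omega⟩) rfl).trans (h3 _ _ rfl (by simp [col]; omega))
    · intro i; exact h4 _
    · intro i j hij
      rw [← h5 ⟨(n + 1, i + 1), by have := i.2; simp only; omega⟩ i rfl rfl]
      exact h1 _ _ rfl (by simp [col]; omega)
    · intro i j hij
      rw [← h5 ⟨(n + 1, i + 1), by have := i.2; simp only; omega⟩ i rfl rfl]
      exact h2 _ _ rfl (by simp [col]; omega)
    · exact fun p q hpq hcc => h1 _ _ hpq hcc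
    · exact fun p q hpq hcc => h2 _ _ hpq hcc
    · exact fun p q hpq hcc => h3 _ _ hpq hcc
    · exact fun p => h4 _
    · rintro ⟨⟨i, c⟩, hp⟩ j h h'
      obtain rfl : i = n := h
      obtain rfl : c = j + 1 := h'
      rfl
    · ext p
      rcases pos_cases hm p with ⟨p, rfl⟩ | ⟨hp, i, hi⟩
      · rw [appendRow_inclPos]
      · rw [appendRow_bottom hm k _ p i hp hi, h5 p i hp hi]
  · rintro ⟨b, ⟨l, hl, hb⟩, rfl⟩
    exact mem_triangles_succ hm hr hk hx hb ((hS l).1 hl).2.2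

theorem appendRow_injective {n m : ℕ} (hm : m = (n + 2) / 2) (k : Fin m → ℤ) :
    Function.Injective (appendRow (n := n) hm k) := by
  intro b c h
  ext p
  rw [← appendRow_inclPos hm k b, h, appendRow_inclPos]

theorem triangles_disjoint {n r : ℕ} (hn : n = 0 → r = 0) (hr : r = (n + 1) / 2) {x : ℤ}
    {l l' : Fin r → ℤ} (h : l ≠ l') : Disjoint (triangles n x l) (triangles n x l') := by
  rw [Set.disjoint_left]
  intro a ha ha'
  refine h (funext fun j => ?_)
  obtain ⟨p, hp, hc⟩ := exists_pos (n := n) (fun h0 => by have := j.2; have := hn h0; omega) hr j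
  rw [← ha.2.2 p j hp hc, ha'.2.2 p j hp hc]

/-- A triangle is determined by its bottom row and the triangle above it. Finiteness travels with
the count because `ncard` is `0` on infinite sets. -/
theorem triangles_succ_ncard {n m r : ℕ} (hm : m = (n + 2) / 2) (hr : r = (n + 1) / 2) {x : ℤ}
    {k : Fin m → ℤ} (hk : StrictMono k) (hx : ∀ i, k i ≤ x) (S : Finset (Fin r → ℤ))
    (hS : ∀ l, l ∈ S ↔ StrictMono l ∧ (∀ i, l i ≤ x) ∧ IsAbove k l)
    (hfin : ∀ l ∈ S, (triangles n x l).Finite) :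
    (triangles (n + 1) x k).Finite ∧
      (triangles (n + 1) x k).ncard = ∑ l ∈ S, (triangles n x l).ncard := by
  rw [triangles_succ_eq hm hr hk hx S hS]
  refine ⟨(S.finite_toSet.biUnion hfin).image _, ?_⟩
  rw [Set.ncard_image_of_injective _ (appendRow_injective hm k),
    S.finite_toSet.ncard_biUnion hfin fun l _ l' _ h => triangles_disjoint (by omega) hr h,
    finsum_mem_coe_finset]

theorem isAbove_iff_odd {m : ℕ} {k : Fin (m + 1) → ℤ} {l : Fin m → ℤ} :
    IsAbove k l ↔ ∀ i : Fin m, k i.castSucc ≤ l i ∧ l i ≤ k i.succ := by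
  constructor
  · exact fun h i => ⟨h.1 _ _ (by simp), h.2 _ _ (by simp)⟩
  · refine fun h => ⟨fun i j hij => ?_, fun i j hij => ?_⟩
    · obtain rfl : i = j.castSucc := Fin.ext hij
      exact (h j).1
    · obtain rfl : i = j.succ := Fin.ext hij
      exact (h j).2

/-- The bound `x` acts as one more entry of the lower row: as `l` increases, bounding its last entry
bounds them all. -/
theorem isAbove_iff_even {m : ℕ} {k : Fin (m + 1) → ℤ} {l : Fin (m + 1) → ℤ} (x : ℤ)
    (hl : StrictMono l) : ((∀ i, l i ≤ x) ∧ IsAbove k l) ↔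
      ∀ i : Fin (m + 1), (Fin.snoc k x : Fin (m + 2) → ℤ) i.castSucc ≤ l i ∧
        l i ≤ (Fin.snoc k x : Fin (m + 2) → ℤ) i.succ := by
  constructor
  · rintro ⟨hx, h⟩ i
    rw [Fin.snoc_castSucc]
    refine ⟨h.1 _ _ rfl, ?_⟩
    induction i using Fin.lastCases with
    | last => simpa using hx _
    | cast i =>
      rw [Fin.succ_castSucc, Fin.snoc_castSucc]
      exact h.2 _ _ (by simp)
  · intro h
    refine ⟨fun i => ?_, fun i j hij => ?_, fun i j hij => ?_⟩
    · have := (h (Fin.last m)).2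
      rw [Fin.succ_last, Fin.snoc_last] at this
      exact (hl.monotone (Fin.le_last i)).trans this
    · obtain rfl : i = j := Fin.ext hij
      simpa using (h i).1
    · obtain ⟨j, rfl⟩ : ∃ j' : Fin m, j = j'.castSucc := ⟨⟨j, by omega⟩, rfl⟩
      have := (h j.castSucc).2
      rw [Fin.succ_castSucc, Fin.snoc_castSucc] at this
      obtain rfl : i = j.succ := Fin.ext hij
      exact this

theorem monotone_snoc_of_le {m : ℕ} {k : Fin m → ℤ} {x : ℤ} (hk : StrictMono k)
    (hx : ∀ i, k i ≤ x) : Monotone (Fin.snoc k x : Fin (m + 1) → ℤ) := by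
  cases m with
  | zero => exact Subsingleton.monotone (α := Fin 1) _
  | succ m => exact monotone_snoc.2 ⟨hk.monotone, hx _⟩

theorem gammaOdd_eq_ncard_of {m : ℕ} {x : ℤ}
    (h : ∀ k : Fin m → ℤ, StrictMono k → (∀ i, k i ≤ x) →
      (triangles (2 * m) x k).Finite ∧ ((triangles (2 * m) x k).ncard : ℤ) = gammaEven x m k)
    (k : Fin (m + 1) → ℤ) (hk : StrictMono k) (hx : ∀ i, k i ≤ x) :
    (triangles (2 * m + 1) x k).Finite ∧
      ((triangles (2 * m + 1) x k).ncard : ℤ) = gammaOdd x m k := by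
  have hle {l : Fin m → ℤ} (hl : l ∈ interlacing k) (i : Fin m) : l i ≤ x :=
    ((mem_interlacing.1 hl).1 i).2.trans (hx _)
  have key := triangles_succ_ncard (n := 2 * m) (by omega) (by omega) hk hx (interlacing k)
    (fun l => ⟨fun hl => ⟨(mem_interlacing.1 hl).2, hle hl,
      isAbove_iff_odd.2 (mem_interlacing.1 hl).1⟩,
      fun hl => mem_interlacing.2 ⟨isAbove_iff_odd.1 hl.2.2, hl.1⟩⟩)
    (fun l hl => (h l (mem_interlacing.1 hl).2 (hle hl)).1)
  refine ⟨key.1, ?_⟩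
  rw [key.2, gammaOdd, sumOp_eq_sum m k _ (hk.comp (Fin.strictMono_castSucc)) hk.monotone]
  push_cast
  exact Finset.sum_congr rfl fun l hl => (h l (mem_interlacing.1 hl).2 (hle hl)).2

theorem gammaEven_eq_ncard_of {m : ℕ} {x : ℤ}
    (h : ∀ k : Fin (m + 1) → ℤ, StrictMono k → (∀ i, k i ≤ x) →
      (triangles (2 * m + 1) x k).Finite ∧
        ((triangles (2 * m + 1) x k).ncard : ℤ) = gammaOdd x m k)
    (k : Fin (m + 1) → ℤ) (hk : StrictMono k) (hx : ∀ i, k i ≤ x) :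
    (triangles (2 * (m + 1)) x k).Finite ∧
      ((triangles (2 * (m + 1)) x k).ncard : ℤ) = gammaEven x (m + 1) k := by
  have key := triangles_succ_ncard (n := 2 * m + 1) (by omega) (by omega) hk hx
    (interlacing (Fin.snoc k x : Fin (m + 2) → ℤ))
    (fun l => ⟨fun hl => ⟨(mem_interlacing.1 hl).2,
      (isAbove_iff_even x (mem_interlacing.1 hl).2).2 (mem_interlacing.1 hl).1⟩,
      fun hl => mem_interlacing.2 ⟨(isAbove_iff_even x hl.1).1 hl.2, hl.1⟩⟩)
    (fun l hl => (h l (mem_interlacing.1 hl).2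
      ((isAbove_iff_even x (mem_interlacing.1 hl).2).2 (mem_interlacing.1 hl).1).1).1)
  refine ⟨key.1, ?_⟩
  rw [show 2 * (m + 1) = 2 * m + 1 + 1 by ring, key.2, gammaEven_succ,
    sumOp_eq_sum _ _ _ (by simpa using hk) (monotone_snoc_of_le hk hx)]
  push_cast
  exact Finset.sum_congr rfl fun l hl => (h l (mem_interlacing.1 hl).2
    ((isAbove_iff_even x (mem_interlacing.1 hl).2).2 (mem_interlacing.1 hl).1).1).2

theorem gammaEven_eq_ncard (m : ℕ) (x : ℤ) (k : Fin m → ℤ) (hk : StrictMono k)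
    (hx : ∀ i, k i ≤ x) : (triangles (2 * m) x k).Finite ∧
      ((triangles (2 * m) x k).ncard : ℤ) = gammaEven x m k := by
  induction m with
  | zero =>
    have hP : IsEmpty (Pos (2 * 0)) := ⟨fun p => by have := p.2; omega⟩
    have : triangles (2 * 0) x k = {fun p => hP.elim p} := by
      ext a
      simp only [Set.mem_singleton_iff, Subsingleton.elim a fun p => hP.elim p, iff_true]
      exact ⟨⟨fun p => hP.elim p, fun p => hP.elim p, fun p => hP.elim p⟩,
        fun p => hP.elim p, fun p => hP.elim p⟩
    rw [this]
    exact ⟨Set.finite_singleton _, by simp [gammaEven]⟩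
  | succ m ih => exact gammaEven_eq_ncard_of (gammaOdd_eq_ncard_of ih) k hk hx

theorem gammaOdd_eq_ncard (m : ℕ) (x : ℤ) (k : Fin (m + 1) → ℤ) (hk : StrictMono k)
    (hx : ∀ i, k i ≤ x) : (triangles (2 * m + 1) x k).Finite ∧
      ((triangles (2 * m + 1) x k).ncard : ℤ) = gammaOdd x m k :=
  gammaOdd_eq_ncard_of (gammaEven_eq_ncard m x) k hk hx

/-! ### Telescoping the summation operator -/

/-- The alternating sum over `j` of `(-1)^j b (k_1 - 1, …, k_{j-1} - 1, k_{j+1}, …, k_{m+1})`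
(with `j` counted from `0` in the sign), defined by splitting off the last argument. -/
noncomputable def altSum : (m : ℕ) → (Fin (m + 1) → ℤ) → ((Fin m → ℤ) → ℂ) → ℂ
  | 0, _, b => b Fin.elim0
  | m + 1, k, b =>
      altSum m (Fin.init k) (fun l => b (Fin.snoc l (k (Fin.last (m + 1))))) +
        (-1) ^ (m + 1) * b (fun i => Fin.init k i - 1)

/-- The composition of the backward differences in all variables. -/
noncomputable def nablaFun : (m : ℕ) → ((Fin m → ℤ) → ℂ) → (Fin m → ℤ) → ℂ
  | 0, b, l => b l
  | m + 1, b, l =>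
      nablaFun m (fun l' => b (Fin.snoc l' (l (Fin.last m))) - b (Fin.snoc l' (l (Fin.last m) - 1)))
        (Fin.init l)

/-- `b (…, t, t, …) - b (…, t - 1, t, …) + b (…, t - 1, t - 1, …) = 0` in neighbouring
arguments. -/
def ShiftVanishing {m : ℕ} (b : (Fin m → ℤ) → ℂ) : Prop :=
  ∀ (i j : Fin m) (l : Fin m → ℤ), (j : ℕ) = i + 1 → l i = l j →
    b l - b (Function.update l i (l i - 1)) +
      b (Function.update (Function.update l i (l i - 1)) j (l j - 1)) = 0

theorem altSum_zero (m : ℕ) (k : Fin (m + 1) → ℤ) : altSum m k (fun _ => 0) = 0 := by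
  induction m with
  | zero => rfl
  | succ m ih => simp [altSum, ih]

theorem altSum_add (m : ℕ) (k : Fin (m + 1) → ℤ) (b c : (Fin m → ℤ) → ℂ) :
    altSum m k (fun l => b l + c l) = altSum m k b + altSum m k c := by
  induction m with
  | zero => rfl
  | succ m ih => simp only [altSum, ih]; ring

theorem altSum_sub (m : ℕ) (k : Fin (m + 1) → ℤ) (b c : (Fin m → ℤ) → ℂ) :
    altSum m k (fun l => b l - c l) = altSum m k b - altSum m k c := by
  induction m with
  | zero => rfl
  | succ m ih => simp only [altSum, ih]; ring

theorem nablaFun_sub (m : ℕ) (b c : (Fin m → ℤ) → ℂ) (l : Fin m → ℤ) :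
    nablaFun m (fun l => b l - c l) l = nablaFun m b l - nablaFun m c l := by
  induction m with
  | zero => rfl
  | succ m ih => simp only [nablaFun, ih]; ring

theorem nablaFun_sum {ι : Type*} (s : Finset ι) (m : ℕ) (c : ι → ℂ) (b : ι → (Fin m → ℤ) → ℂ)
    (l : Fin m → ℤ) :
    nablaFun m (fun l => ∑ i ∈ s, c i * b i l) l = ∑ i ∈ s, c i * nablaFun m (b i) l := by
  induction m with
  | zero => rfl
  | succ m ih => simp only [nablaFun, ← Finset.sum_sub_distrib, ← mul_sub, ih]

theorem nablaFun_prod (m : ℕ) (f : Fin m → ℤ → ℂ) (l : Fin m → ℤ) :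
    nablaFun m (fun l => ∏ i, f i (l i)) l = ∏ i, (f i (l i) - f i (l i - 1)) := by
  induction m with
  | zero => simp [nablaFun]
  | succ m ih =>
    simp only [nablaFun, Fin.prod_univ_castSucc, Fin.snoc_castSucc, Fin.snoc_last, ← mul_sub]
    have := nablaFun_sum {()} m
      (fun _ => f (Fin.last m) (l (Fin.last m)) - f (Fin.last m) (l (Fin.last m) - 1))
      (fun _ l => ∏ i : Fin m, f i.castSucc (l i)) (Fin.init l)
    simp only [Finset.sum_singleton] at this
    simp only [mul_comm _ (f (Fin.last m) (l (Fin.last m)) - f (Fin.last m) (l (Fin.last m) - 1)),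
      this, ih (fun i => f i.castSucc), Fin.init]

theorem sum_Icc_telescope (g : ℤ → ℂ) (a : ℤ) (n : ℕ) :
    ∑ t ∈ Finset.Icc a (a + n - 1), (g t - g (t - 1)) = g (a + n - 1) - g (a - 1) := by
  induction n with
  | zero => simp
  | succ n ih =>
    have h : Finset.Icc a (a + (n + 1 : ℕ) - 1) = insert (a + n) (Finset.Icc a (a + n - 1)) := by
      ext; simp; omega
    rw [h, Finset.sum_insert (by simp), ih]
    have : a + ((n + 1 : ℕ) : ℤ) - 1 = a + n := by push_cast; ring
    rw [this]; ring

/-- The sign convention for reversed limits is exactly what makes telescoping valid without assuming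
`a ≤ b`; this is why the final formula holds for all integers. -/
theorem extSum_telescope {f : ℤ → ℤ} {g : ℤ → ℂ} (h : ∀ t, (f t : ℂ) = g t - g (t - 1))
    (a b : ℤ) : (extSum a b f : ℂ) = g b - g (a - 1) := by
  unfold extSum
  split_ifs with hab
  · push_cast
    simp only [h]
    obtain ⟨n, hn⟩ := Int.eq_ofNat_of_zero_le (show 0 ≤ b - a + 1 by omega)
    obtain rfl : b = a + n - 1 := by omega
    exact sum_Icc_telescope g a n
  · push_cast
    simp only [h]
    obtain ⟨n, hn⟩ := Int.eq_ofNat_of_zero_le (show 0 ≤ a - (b + 1) by omega)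
    obtain rfl : a = b + 1 + n := by omega
    rw [sum_Icc_telescope g (b + 1) n]
    simp

theorem ShiftVanishing.snoc {m : ℕ} {b : (Fin (m + 1) → ℤ) → ℂ} (h : ShiftVanishing b) (v : ℤ) :
    ShiftVanishing (fun l : Fin m → ℤ => b (Fin.snoc l v)) := by
  intro i j l hij hl
  have := h i.castSucc j.castSucc (Fin.snoc l v) (by simpa using hij) (by simpa using hl)
  simpa [Fin.snoc_update] using this

theorem ShiftVanishing.last {m : ℕ} {b : (Fin (m + 2) → ℤ) → ℂ} (h : ShiftVanishing b)
    (l : Fin m → ℤ) (u : ℤ) :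
    b (Fin.snoc (Fin.snoc l u : Fin (m + 1) → ℤ) u) -
      b (Fin.snoc (Fin.snoc l (u - 1) : Fin (m + 1) → ℤ) u) +
      b (Fin.snoc (Fin.snoc l (u - 1) : Fin (m + 1) → ℤ) (u - 1)) = 0 := by
  have := h (Fin.last m).castSucc (Fin.last (m + 1))
    (Fin.snoc (Fin.snoc l u : Fin (m + 1) → ℤ) u) (by simp) (by simp)
  simpa [← Fin.snoc_update, Fin.update_snoc_last] using this

theorem ShiftVanishing.sub {m : ℕ} {b c : (Fin m → ℤ) → ℂ} (hb : ShiftVanishing b)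
    (hc : ShiftVanishing c) : ShiftVanishing (fun l => b l - c l) := by
  intro i j l hij hl
  linear_combination hb i j l hij hl - hc i j l hij hl

theorem sumOp_eq_altSum (m : ℕ) (k : Fin (m + 1) → ℤ) (a : (Fin m → ℤ) → ℤ)
    (b : (Fin m → ℤ) → ℂ) (hb : ShiftVanishing b) (hab : ∀ l, (a l : ℂ) = nablaFun m b l) :
    (sumOp m k a : ℂ) = altSum m k b := by
  induction m using Nat.twoStepInduction with
  | zero => exact hab _
  | one =>
    have h (l : Fin 1 → ℤ) : l = fun _ => l 0 := by ext i; rw [Subsingleton.elim i 0]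
    rw [sumOp, extSum_telescope (g := fun t => b (fun _ => t))]
    · have h1 : (Fin.snoc (Fin.elim0 : Fin 0 → ℤ) (k (Fin.last 1)) : Fin 1 → ℤ)
        = fun _ => k 1 := by rw [h (Fin.snoc _ _)]; rfl
      have h2 : (fun i : Fin 1 => Fin.init k i - 1) = fun _ => k 0 - 1 := by
        rw [h (fun i : Fin 1 => Fin.init k i - 1)]; rfl
      simp only [altSum, h1, h2]
      ring
    · intro t
      rw [hab, nablaFun, nablaFun]
      congr 2
  | more m _ ih =>
    simp only [sumOp]
    set k' : Fin (m + 2) → ℤ := Fin.init k with hk'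
    set u : ℤ := k' (Fin.last (m + 1)) with hu
    set k'' : Fin (m + 1) → ℤ := Fin.init k' with hk''
    set v := k (Fin.last (m + 2)) with hv
    have hn (l : Fin (m + 1) → ℤ) (t : ℤ) : (a (Fin.snoc l t) : ℂ) =
        nablaFun (m + 1) (fun l' => b (Fin.snoc l' t)) l -
          nablaFun (m + 1) (fun l' => b (Fin.snoc l' (t - 1))) l := by
      rw [hab, nablaFun, Fin.snoc_last, Fin.init_snoc, nablaFun_sub]
    push_cast
    rw [ih k' _ (fun l => b (Fin.snoc l v) - b (Fin.snoc l u)) ((hb.snoc v).sub (hb.snoc u)),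
      ih (Fin.snoc k'' (u - 1)) _ (fun l => b (Fin.snoc l u) - b (Fin.snoc l (u - 1)))
        ((hb.snoc u).sub (hb.snoc (u - 1)))]
    · rw [altSum_sub, altSum_sub]
      conv_rhs => rw [altSum]
      have hk1 : k' = Fin.snoc k'' u := (Fin.snoc_init_self k').symm
      have hs (w : ℤ) (c : (Fin (m + 1) → ℤ) → ℂ) : altSum (m + 1) (Fin.snoc k'' w) c =
          altSum m k'' (fun l => c (Fin.snoc l w)) + (-1) ^ (m + 1) * c (fun i => k'' i - 1) := by
        rw [altSum, Fin.snoc_last, Fin.init_snoc]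
      have h0 := altSum_zero m k''
      rw [← funext fun l => hb.last l u, altSum_add, altSum_sub] at h0
      have h1 : (fun i => Fin.init k i - 1) = (Fin.snoc (fun i => k'' i - 1) (u - 1) :
          Fin (m + 2) → ℤ) := by
        ext i
        rw [← hk', hk1]
        induction i using Fin.lastCases <;> simp
      rw [h1, ← hk', ← hv]
      have e := hs u (fun l => b (Fin.snoc l u))
      rw [← hk1] at e
      rw [e, hs, hs]
      -- Both values at `(k'' - 1, u)` cancel, and the remaining sums over `k''` combine to the
      -- vanishing `h0`. What survives is the value at `(k'' - 1, u - 1)`, the new last term of the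
      -- alternating sum.
      linear_combination -h0
    · intro l
      rw [hn, nablaFun_sub]
    · intro l
      rw [extSum_telescope (hn l), nablaFun_sub]
      simp

theorem altSum_eq_sum (m : ℕ) (k : Fin (m + 1) → ℤ) (b : (Fin m → ℤ) → ℂ) :
    altSum m k b = ∑ j : Fin (m + 1), (-1) ^ (j : ℕ) *
      b (fun i => k (j.succAbove i) - if i.castSucc < j then 1 else 0) := by
  induction m with
  | zero =>
    rw [Fin.sum_univ_one, Fin.val_zero, pow_zero, one_mul]
    exact congrArg b (Subsingleton.elim _ _)
  | succ m ih =>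
    conv_rhs => rw [Fin.sum_univ_castSucc]
    rw [altSum, ih]
    congr 1
    · refine Finset.sum_congr rfl fun j _ => ?_
      congr 2
      ext i
      induction i using Fin.lastCases with
      | last => simp [not_lt.2 (Fin.le_last _)]
      | cast i => simp [Fin.init]
    · simp [Fin.init, Fin.castSucc_lt_last]

open MvPolynomial

/-! ### Shifts and evaluation -/

theorem E_val_apply {m : ℕ} (i : Fin m) (f : MvPolynomial (Fin m) ℂ) :
    (E i : Op m) f = shiftHom i 1 f := rfl

theorem E_inv_apply {m : ℕ} (i : Fin m) (f : MvPolynomial (Fin m) ℂ) :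
    ((E i)⁻¹ : (Op m)ˣ).val f = shiftHom i (-1) f := rfl

theorem shiftHom_X_self {m : ℕ} (i : Fin m) (c : ℂ) : shiftHom i c (X i) = X i + C c := by
  simp [shiftHom]

theorem shiftHom_X_of_ne {m : ℕ} {i j : Fin m} (h : j ≠ i) (c : ℂ) :
    shiftHom i c (X j) = X j := by
  simp [shiftHom, h]

theorem eval_shiftHom {m : ℕ} (k : Fin m → ℂ) (i : Fin m) (c : ℂ) (f : MvPolynomial (Fin m) ℂ) :
    eval k (shiftHom i c f) = eval (Function.update k i (k i + c)) f := by
  have : (aeval k).comp (shiftHom i c) = aeval (R := ℂ) (Function.update k i (k i + c)) := by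
    ext j
    by_cases h : j = i
    · subst h; simp [shiftHom_X_self]
    · simp [shiftHom_X_of_ne h, h]
  simpa [coe_aeval_eq_eval] using DFunLike.congr_fun this f

theorem evalAt_E_inv {m : ℕ} (k : Fin m → ℤ) (i : Fin m) (f : MvPolynomial (Fin m) ℂ) :
    evalAt k (((E i)⁻¹ : (Op m)ˣ).val f) = evalAt (Function.update k i (k i - 1)) f := by
  rw [evalAt, E_inv_apply, eval_shiftHom, evalAt]
  congr 2
  ext j
  by_cases h : j = i
  · subst h; simp [sub_eq_add_neg]
  · simp [h]

/-! ### Invertibility -/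

/-- The geometric series in `-N` is finite on each polynomial, though its length depends on the
polynomial; bijectivity is therefore checked pointwise. -/
theorem isUnit_one_add_of_locally_nilpotent {m : ℕ} {N : Op m} (h : ∀ f, ∃ n : ℕ, (N ^ n) f = 0) :
    IsUnit (1 + N) := by
  rw [Module.End.isUnit_iff]
  have hs (n : ℕ) : (1 + N) * (∑ i ∈ Finset.range n, (-N) ^ i) = 1 - (-N) ^ n := by
    rw [← mul_neg_geom_sum, sub_neg_eq_add]
  have hs' (n : ℕ) : (∑ i ∈ Finset.range n, (-N) ^ i) * (1 + N) = 1 - (-N) ^ n := by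
    rw [← geom_sum_mul_neg, sub_neg_eq_add]
  have hn {n : ℕ} {f : MvPolynomial (Fin m) ℂ} (hf : (N ^ n) f = 0) : ((-N) ^ n) f = 0 := by
    have : (-N) ^ n = (-1) ^ n * N ^ n := neg_pow N n
    rw [this, Module.End.mul_apply, hf, map_zero]
  constructor
  · rw [injective_iff_map_eq_zero]
    intro f hf
    obtain ⟨n, hnf⟩ := h f
    have := LinearMap.congr_fun (hs' n) f
    rw [Module.End.mul_apply, hf, map_zero, LinearMap.sub_apply, hn hnf, sub_zero] at this
    exact this.symm
  · intro f
    obtain ⟨n, hnf⟩ := h f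
    refine ⟨(∑ i ∈ Finset.range n, (-N) ^ i) f, ?_⟩
    rw [← Module.End.mul_apply, hs, LinearMap.sub_apply, hn hnf, sub_zero]
    rfl

theorem pow_apply_eq_zero_of_le {m : ℕ} {T : Op m} {f : MvPolynomial (Fin m) ℂ} {n n' : ℕ}
    (h : n ≤ n') (hf : (T ^ n) f = 0) : (T ^ n') f = 0 := by
  rw [← Nat.sub_add_cancel h, pow_add, Module.End.mul_apply, hf, map_zero]

theorem Delta_apply {m : ℕ} (p : Fin m) (f : MvPolynomial (Fin m) ℂ) :
    Delta p f = shiftHom p 1 f - f := rfl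

theorem Delta_commute_E {m : ℕ} (p q : Fin m) : Commute (Delta p) (E q : Op m) :=
  (E_commute p q).sub_left (Commute.one_left _)

/-- By the product rule, `Δ_p (f k_i)` is `(Δ_p f) k_i`, plus `E_p f` when `i = p`. The first term
is handled by induction, the second because `E_p` commutes with `Δ_p`. -/
theorem Delta_pow_X_mul {m : ℕ} (p i : Fin m) (n : ℕ) (f : MvPolynomial (Fin m) ℂ)
    (hf : (Delta p ^ n) f = 0) : ∃ n' : ℕ, (Delta p ^ n') (f * X i) = 0 := by
  induction n generalizing f with
  | zero => exact ⟨0, by rw [pow_zero, Module.End.one_apply] at hf; simp [hf]⟩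
  | succ n ih =>
    rw [pow_succ, Module.End.mul_apply] at hf
    obtain ⟨n', hn'⟩ := ih _ hf
    have hE : (Delta p ^ (n + 1)) ((E p : Op m) f) = 0 := by
      rw [← Module.End.mul_apply, ((Delta_commute_E p p).pow_left (n + 1)).eq,
        Module.End.mul_apply, pow_succ, Module.End.mul_apply, hf, map_zero]
    refine ⟨max n' (n + 1) + 1, ?_⟩
    rw [pow_succ, Module.End.mul_apply]
    have key : Delta p (f * X i) =
        Delta p f * X i + (if i = p then (1 : ℂ) else 0) • (E p : Op m) f := by
      split_ifs with h
      · subst h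
        simp only [Delta_apply, map_mul, shiftHom_X_self, E_val_apply, one_smul, map_one]
        ring
      · simp only [Delta_apply, map_mul, shiftHom_X_of_ne h, zero_smul]
        ring
    rw [key, map_add, map_smul, pow_apply_eq_zero_of_le (le_max_left _ _) hn',
      pow_apply_eq_zero_of_le (le_max_right _ _) hE, smul_zero, add_zero]

theorem Delta_locally_nilpotent {m : ℕ} (p : Fin m) (f : MvPolynomial (Fin m) ℂ) :
    ∃ n : ℕ, (Delta p ^ n) f = 0 := by
  induction f using MvPolynomial.induction_on with
  | C a => exact ⟨1, by simp [Delta_apply, algHom_C, algebraMap_eq]⟩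
  | add f g hf hg =>
    obtain ⟨n, hn⟩ := hf
    obtain ⟨n', hn'⟩ := hg
    exact ⟨max n n', by rw [map_add, pow_apply_eq_zero_of_le (le_max_left _ _) hn,
      pow_apply_eq_zero_of_le (le_max_right _ _) hn', add_zero]⟩
  | mul_X f i hf =>
    obtain ⟨n, hn⟩ := hf
    exact Delta_pow_X_mul p i n f hn

theorem isUnit_one_add_mul_Delta {m : ℕ} (p : Fin m) {T : Op m} (h : Commute T (Delta p)) :
    IsUnit (1 + T * Delta p) := by
  refine isUnit_one_add_of_locally_nilpotent fun f => ?_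
  obtain ⟨n, hn⟩ := Delta_locally_nilpotent p f
  exact ⟨n, by rw [h.mul_pow, Module.End.mul_apply, hn, map_zero]⟩

theorem isUnit_opA {m : ℕ} (p q : Fin m) : IsUnit (opA p q) :=
  isUnit_one_add_mul_Delta p (Delta_commute_E p q).symm

theorem isUnit_opB {m : ℕ} (p q : Fin m) : IsUnit (opB p q) :=
  isUnit_one_add_mul_Delta p (Delta_commute_E p q).units_inv_right.symm

theorem opA_commute_E {m : ℕ} (p q r : Fin m) : Commute (opA p q) (E r : Op m) :=
  (Commute.one_left _).add_left ((E_commute q r).mul_left (Delta_commute_E p r))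

theorem opB_commute_E {m : ℕ} (p q r : Fin m) : Commute (opB p q) (E r : Op m) :=
  (Commute.one_left _).add_left ((E_commute r q).units_inv_right.symm.mul_left
    (Delta_commute_E p r))

theorem opA_commute_opB {m : ℕ} (p q : Fin m) : Commute (opA p q) (opB p q) := by
  have hD : Commute (opA p q) (Delta p) := (opA_commute_E p q p).sub_right (Commute.one_right _)
  exact (Commute.one_right _).add_right ((opA_commute_E p q q).units_inv_right.mul_right hD)

/-- This relation determines `factor p q` without inverses, and its left multiplier is unchanged
when `E_q` and `E_q⁻¹` are exchanged. -/
theorem opA_mul_opB_mul_factor {m : ℕ} (p q : Fin m) :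
    opA p q * opB p q * factor p q = (E p : Op m) := by
  rw [(opA_commute_opB p q).eq, factor, mul_assoc, ← mul_assoc (opA p q), ← mul_assoc (opA p q),
    Ring.mul_inverse_cancel _ (isUnit_opA p q), one_mul, ← mul_assoc, (opB_commute_E p q p).eq,
    mul_assoc, Ring.mul_inverse_cancel _ (isUnit_opB p q), mul_one]

/-! ### Intertwining maps -/

/-- `φ` carries the operator `S` to the operator `T`. -/
def Intertwines {m n : ℕ} (φ : MvPolynomial (Fin m) ℂ →ₗ[ℂ] MvPolynomial (Fin n) ℂ)
    (S : Op m) (T : Op n) : Prop :=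
  ∀ f, T (φ f) = φ (S f)

section Intertwines

variable {m n : ℕ} {φ : MvPolynomial (Fin m) ℂ →ₗ[ℂ] MvPolynomial (Fin n) ℂ} {S S' : Op m}
  {T T' : Op n}

theorem Intertwines.one : Intertwines φ 1 1 := fun _ => rfl

theorem Intertwines.mul (h : Intertwines φ S T) (h' : Intertwines φ S' T') :
    Intertwines φ (S * S') (T * T') := fun f => by
  rw [Module.End.mul_apply, h', h, Module.End.mul_apply]

theorem Intertwines.add (h : Intertwines φ S T) (h' : Intertwines φ S' T') :
    Intertwines φ (S + S') (T + T') := fun f => by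
  rw [LinearMap.add_apply, LinearMap.add_apply, map_add, h, h']

theorem Intertwines.sub (h : Intertwines φ S T) (h' : Intertwines φ S' T') :
    Intertwines φ (S - S') (T - T') := fun f => by
  rw [LinearMap.sub_apply, LinearMap.sub_apply, map_sub, h, h']

/-- Cancelling an invertible operator on the target side lets inverses be carried across `φ` through
the relations that define them. -/
theorem Intertwines.of_mul {U : Op m} {V : Op n} (hV : IsUnit V) (h : Intertwines φ U V)
    (h' : Intertwines φ (U * S) (V * T)) : Intertwines φ S T := fun f => by
  refine ((Module.End.isUnit_iff V).1 hV).1 ?_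
  have := h' f
  rw [Module.End.mul_apply, Module.End.mul_apply] at this
  rw [this, h]

theorem Intertwines.inv {U : (Op m)ˣ} {V : (Op n)ˣ} (h : Intertwines φ U V) :
    Intertwines φ (U⁻¹ : (Op m)ˣ) (V⁻¹ : (Op n)ˣ) :=
  Intertwines.of_mul V.isUnit h (by rw [Units.mul_inv, Units.mul_inv]; exact Intertwines.one)

theorem Intertwines.factor {p q : Fin n} (h : Intertwines φ S (opA p q * opB p q))
    (h' : Intertwines φ (S * S') (E p : Op n)) : Intertwines φ S' (factor p q) :=
  Intertwines.of_mul ((isUnit_opA p q).mul (isUnit_opB p q)) h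
    (by rwa [opA_mul_opB_mul_factor])

theorem intertwines_algHom {φ : MvPolynomial (Fin m) ℂ →ₐ[ℂ] MvPolynomial (Fin n) ℂ}
    {S : MvPolynomial (Fin m) ℂ →ₐ[ℂ] MvPolynomial (Fin m) ℂ}
    {T : MvPolynomial (Fin n) ℂ →ₐ[ℂ] MvPolynomial (Fin n) ℂ}
    (h : ∀ i, T (φ (X i)) = φ (S (X i))) :
    Intertwines φ.toLinearMap S.toLinearMap T.toLinearMap := by
  have : T.comp φ = φ.comp S := by ext1 i; exact h i
  exact fun f => DFunLike.congr_fun this f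

end Intertwines

/-! ### Renaming variables and inserting an unused variable -/

theorem rename_intertwines_E {m n : ℕ} {g : Fin m → Fin n} (hg : Function.Injective g)
    (i : Fin m) : Intertwines (rename g).toLinearMap (E i : Op m) (E (g i) : Op n) := by
  refine intertwines_algHom fun j => ?_
  by_cases h : j = i
  · subst h; simp [shiftHom_X_self]
  · simp [shiftHom_X_of_ne h, shiftHom_X_of_ne (hg.ne h)]

theorem rename_intertwines_factor {m n : ℕ} {g : Fin m → Fin n} (hg : Function.Injective g)
    (p q : Fin m) :
    Intertwines (rename g).toLinearMap (factor p q) (factor (g p) (g q)) := by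
  have hp := rename_intertwines_E hg p
  have hq := rename_intertwines_E hg q
  have hD := hp.sub Intertwines.one
  refine Intertwines.factor (S := opA p q * opB p q)
    ((Intertwines.one.add (hq.mul hD)).mul (Intertwines.one.add (hq.inv.mul hD))) ?_
  rw [opA_mul_opB_mul_factor]
  exact hp

theorem rename_succAbove_intertwines_E_self {m : ℕ} (j : Fin (m + 1)) :
    Intertwines (rename j.succAbove).toLinearMap (1 : Op m) (E j : Op (m + 1)) := by
  refine intertwines_algHom (S := AlgHom.id ℂ _) fun i => ?_
  simp [shiftHom_X_of_ne (Fin.succAbove_ne j i)]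

/-- On polynomials free of `k_j` the shift `E_j` is the identity, so both `opA` and `opB` become `1
+ Δ_p = E_p`, and the factor becomes `E_p⁻¹ E_p E_p⁻¹`. -/
theorem rename_succAbove_intertwines_factor_left {m : ℕ} (j : Fin (m + 1)) (p : Fin m) :
    Intertwines (rename j.succAbove).toLinearMap ((E p)⁻¹ : (Op m)ˣ)
      (factor (j.succAbove p) j) := by
  have hp := rename_intertwines_E (Fin.succAbove_right_injective (p := j)) p
  have hj := rename_succAbove_intertwines_E_self j
  have hj' := hj.inv (U := 1)
  have hD := hp.sub Intertwines.one
  have h := (Intertwines.one.add (hj.mul hD)).mul (Intertwines.one.add (hj'.mul hD))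
  simp only [inv_one, Units.val_one, one_mul, add_sub_cancel] at h
  refine Intertwines.factor h ?_
  rwa [mul_assoc, Units.mul_inv, mul_one]

/-- Here `Δ_j` vanishes on the image, so `opA`, `opB` and `E_j` all act as the identity. -/
theorem rename_succAbove_intertwines_factor_right {m : ℕ} (j : Fin (m + 1)) (q : Fin m) :
    Intertwines (rename j.succAbove).toLinearMap (1 : Op m) (factor j (j.succAbove q)) := by
  have hq := rename_intertwines_E (Fin.succAbove_right_injective (p := j)) q
  have hj := rename_succAbove_intertwines_E_self j
  have hD := hj.sub Intertwines.one
  have h := (Intertwines.one.add (hq.mul hD)).mul (Intertwines.one.add (hq.inv.mul hD))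
  simp only [sub_self, mul_zero, add_zero, mul_one] at h
  refine Intertwines.factor h ?_
  rwa [one_mul]

/-! ### Reflecting one variable -/

/-- The substitution `k_i ↦ c - k_i`. -/
noncomputable def reflHom {m : ℕ} (i : Fin m) (c : ℂ) :
    MvPolynomial (Fin m) ℂ →ₐ[ℂ] MvPolynomial (Fin m) ℂ :=
  aeval (Function.update X i (C c - X i))

theorem reflHom_X_self {m : ℕ} (i : Fin m) (c : ℂ) : reflHom i c (X i) = C c - X i := by
  simp [reflHom]

theorem reflHom_X_of_ne {m : ℕ} {i j : Fin m} (h : j ≠ i) (c : ℂ) :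
    reflHom i c (X j) = X j := by
  simp [reflHom, h]

theorem eval_reflHom {m : ℕ} (k : Fin m → ℂ) (i : Fin m) (c : ℂ) (f : MvPolynomial (Fin m) ℂ) :
    eval k (reflHom i c f) = eval (Function.update k i (c - k i)) f := by
  have : (aeval k).comp (reflHom i c) = aeval (R := ℂ) (Function.update k i (c - k i)) := by
    ext j
    by_cases h : j = i
    · subst h; simp [reflHom_X_self]
    · simp [reflHom_X_of_ne h, h]
  simpa [coe_aeval_eq_eval] using DFunLike.congr_fun this f

theorem reflHom_intertwines_E_of_ne {m : ℕ} {i p : Fin m} (h : p ≠ i) (c : ℂ) :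
    Intertwines (reflHom i c).toLinearMap (E p : Op m) (E p : Op m) := by
  refine intertwines_algHom fun j => ?_
  by_cases hj : j = i
  · subst hj
    simp [reflHom_X_self, shiftHom_X_of_ne h.symm, algHom_C, algebraMap_eq]
  · by_cases hp : j = p
    · subst hp
      simp [reflHom_X_of_ne hj, shiftHom_X_self]
    · simp [reflHom_X_of_ne hj, shiftHom_X_of_ne hp]

theorem reflHom_intertwines_E_self {m : ℕ} (i : Fin m) (c : ℂ) :
    Intertwines (reflHom i c).toLinearMap (E i : Op m) ((E i)⁻¹ : (Op m)ˣ) := by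
  refine intertwines_algHom (T := shiftHom i (-1)) fun j => ?_
  by_cases hj : j = i
  · subst hj
    simp [reflHom_X_self, shiftHom_X_self, algHom_C, algebraMap_eq]
    ring
  · simp [reflHom_X_of_ne hj, shiftHom_X_of_ne hj]

/-- Reflecting `k_q` inverts `E_q`, which merely exchanges `opA p q` and `opB p q`. The reflected
index must not be `p`. -/
theorem reflHom_intertwines_factor {m : ℕ} {i p q : Fin m} (h : p ≠ i) (c : ℂ) :
    Intertwines (reflHom i c).toLinearMap (factor p q) (factor p q) := by
  have hp := reflHom_intertwines_E_of_ne h c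
  have hD := hp.sub Intertwines.one
  refine Intertwines.factor (S := opA p q * opB p q) ?_ (by rwa [opA_mul_opB_mul_factor])
  by_cases hq : q = i
  · subst hq
    have hq := reflHom_intertwines_E_self q c
    have hq' := hq.inv
    rw [inv_inv] at hq'
    have : Intertwines (reflHom q c).toLinearMap (opA p q * opB p q) (opB p q * opA p q) :=
      (Intertwines.one.add (hq.mul hD)).mul (Intertwines.one.add (hq'.mul hD))
    rwa [← (opA_commute_opB p q).eq] at this
  · have hq := reflHom_intertwines_E_of_ne hq c
    exact (Intertwines.one.add (hq.mul hD)).mul (Intertwines.one.add (hq.inv.mul hD))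

/-! ### The commutative algebra of the operators -/

/-- A commutative algebra of operators that contains the shifts and the operators `factor p q`. -/
noncomputable def shiftAlg (m : ℕ) : Subalgebra ℂ (Op m) :=
  Subalgebra.centralizer ℂ
    (Subalgebra.centralizer ℂ (Set.range fun i : Fin m => (E i : Op m)) : Set (Op m))

/-- The double centralizer of the commuting shifts is commutative and, unlike the algebra they
generate, visibly contains the inverses in `factor p q`. -/
theorem mem_shiftAlg {m : ℕ} {T : Op m} :
    T ∈ shiftAlg m ↔ ∀ S : Op m, (∀ i : Fin m, Commute S (E i : Op m)) → Commute S T := by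
  simp only [shiftAlg, Subalgebra.mem_centralizer_iff, SetLike.mem_coe, Set.forall_mem_range]
  exact forall_congr' fun S => imp_congr_left (forall_congr' fun i => eq_comm)

theorem E_mem_shiftAlg {m : ℕ} (i : Fin m) : (E i : Op m) ∈ shiftAlg m :=
  mem_shiftAlg.2 fun _ h => h i

theorem E_inv_mem_shiftAlg {m : ℕ} (i : Fin m) : ((E i)⁻¹ : (Op m)ˣ).val ∈ shiftAlg m :=
  mem_shiftAlg.2 fun _ h => (h i).units_inv_right

theorem factor_mem_shiftAlg {m : ℕ} (p q : Fin m) : factor p q ∈ shiftAlg m :=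
  mem_shiftAlg.2 fun _ h => commute_factor h p q

noncomputable instance (m : ℕ) : CommRing (shiftAlg m) :=
  { (inferInstance : Ring (shiftAlg m)) with
    mul_comm := fun S T => Subtype.ext <| mem_shiftAlg.1 T.2 S.1 fun i =>
      (mem_shiftAlg.1 S.2 _ fun j => E_commute i j).symm }

/-- The shift `E i` as an element of the commutative algebra. -/
noncomputable def sE {m : ℕ} (i : Fin m) : shiftAlg m := ⟨_, E_mem_shiftAlg i⟩

/-- The inverse shift as an element of the commutative algebra. -/
noncomputable def sEinv {m : ℕ} (i : Fin m) : shiftAlg m := ⟨_, E_inv_mem_shiftAlg i⟩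

/-- `factor p q` as an element of the commutative algebra. -/
noncomputable def sFactor {m : ℕ} (p q : Fin m) : shiftAlg m := ⟨_, factor_mem_shiftAlg p q⟩

theorem sE_mul_sEinv {m : ℕ} (i : Fin m) : sE i * sEinv i = 1 :=
  Subtype.ext (Units.mul_inv (E i))

theorem sFactor_relation {m : ℕ} (p q : Fin m) :
    (1 + sE q * (sE p - 1)) * (1 + sEinv q * (sE p - 1)) * sFactor p q = sE p :=
  Subtype.ext (opA_mul_opB_mul_factor p q)

theorem Intertwines.prod {ι : Type*} {m n : ℕ}
    {φ : MvPolynomial (Fin m) ℂ →ₗ[ℂ] MvPolynomial (Fin n) ℂ} (s : Finset ι)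
    {S : ι → shiftAlg m} {T : ι → shiftAlg n}
    (h : ∀ i ∈ s, Intertwines φ (S i : Op m) (T i : Op n)) :
    Intertwines φ (∏ i ∈ s, S i : shiftAlg m) (∏ i ∈ s, T i : shiftAlg n) := by
  classical
  induction s using Finset.induction_on with
  | empty => exact Intertwines.one
  | insert a s ha ih =>
    rw [Finset.prod_insert ha, Finset.prod_insert ha]
    exact (h a (Finset.mem_insert_self a s)).mul
      (ih fun i hi => h i (Finset.mem_insert_of_mem hi))

/-- `prodOp m` as an element of the commutative algebra. -/
noncomputable def sProd (m : ℕ) : shiftAlg m :=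
  ∏ s ∈ Finset.univ.filter (fun s : Fin m × Fin m => s.1 < s.2), sFactor s.1 s.2

theorem coe_sProd (m : ℕ) : (sProd m : Op m) = prodOp m := by
  rw [sProd, ← Finset.noncommProd_eq_prod]
  exact Finset.map_noncommProd _ _ _ (shiftAlg m).val

theorem sProd_eq (m : ℕ) :
    sProd m = ∏ p : Fin m, ∏ q : Fin m, if p < q then sFactor p q else 1 := by
  rw [sProd, Finset.prod_filter, Fintype.prod_prod_type]

/-! ### Symmetries of the product operator -/

/-- The prefactor equals `E_i⁻¹ E_j⁻¹ opA i j`, and `opB i j` equals `E_j⁻¹ (E_i + E_j - 1)`. So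
prefactor times factor is the inverse of `E_i + E_j - 1`, which is symmetric in `i` and `j`. -/
theorem mul_sFactor_mul_eq_one {m : ℕ} (i j : Fin m) :
    (sE i + sE j - 1) * ((1 - sEinv i + sEinv i * sEinv j) * sFactor i j) = 1 := by
  have hi := sE_mul_sEinv i
  have hj := sE_mul_sEinv j
  have h := sFactor_relation i j
  have h1 : 1 - sEinv i + sEinv i * sEinv j = sEinv i * sEinv j * (1 + sE j * (sE i - 1)) := by
    linear_combination (-(sE j * sEinv j)) * hi - hj + sEinv i * hj
  have h2 : 1 + sEinv j * (sE i - 1) = sEinv j * (sE i + sE j - 1) := by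
    linear_combination -hj
  rw [h2] at h
  rw [h1]
  linear_combination sEinv i * h + hi

theorem swap_intertwines {m : ℕ} {i j : Fin m} (hij : (j : ℕ) = i + 1) :
    Intertwines (rename (Equiv.swap i j)).toLinearMap
      ((1 - sEinv i + sEinv i * sEinv j) * sProd m : shiftAlg m)
      ((1 - sEinv i + sEinv i * sEinv j) * sProd m : shiftAlg m) := by
  classical
  have hinj := (Equiv.swap i j).injective
  have hlt : (i, j) ∈ Finset.univ.filter (fun s : Fin m × Fin m => s.1 < s.2) :=
    Finset.mem_filter.2 ⟨Finset.mem_univ _, Fin.lt_def.2 (by simp only; omega)⟩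
  have hmul := mul_sFactor_mul_eq_one i j
  rw [sProd, ← Finset.mul_prod_erase _ _ hlt, ← mul_assoc]
  refine Intertwines.mul ?_ ?_
  · have hi := rename_intertwines_E hinj i
    have hj := rename_intertwines_E hinj j
    rw [Equiv.swap_apply_left] at hi
    rw [Equiv.swap_apply_right] at hj
    have hX : Intertwines (rename (Equiv.swap i j)).toLinearMap
        (sE i + sE j - 1 : shiftAlg m) (sE i + sE j - 1 : shiftAlg m) := by
      have := (hi.add hj).sub Intertwines.one
      rwa [add_comm (E j : Op m)] at this
    have hu : IsUnit ((sE i + sE j - 1 : shiftAlg m) : Op m) :=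
      (IsUnit.of_mul_eq_one _ hmul).map (shiftAlg m).val
    refine Intertwines.of_mul hu hX ?_
    rw [← Subalgebra.coe_mul, hmul]
    exact Intertwines.one
  · set S := (Finset.univ.filter (fun s : Fin m × Fin m => s.1 < s.2)).erase (i, j) with hS
    -- Exchanging adjacent indices preserves the order of every pair except `(i, j)` itself, so the
    -- remaining factors are permuted.
    have hmem (s : Fin m × Fin m) (hs : s ∈ S) :
        (Equiv.swap i j s.1, Equiv.swap i j s.2) ∈ S := by
      obtain ⟨p, q⟩ := s
      simp only [hS, Finset.mem_erase, Finset.mem_filter, Finset.mem_univ, true_and, ne_eq,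
        Prod.mk.injEq, Fin.lt_def, Equiv.swap_apply_def, Fin.ext_iff] at hs ⊢
      split_ifs <;> omega
    have hS' : ∏ s ∈ S, sFactor s.1 s.2 =
        ∏ s ∈ S, sFactor (Equiv.swap i j s.1) (Equiv.swap i j s.2) :=
      Finset.prod_bij' (fun s _ => (Equiv.swap i j s.1, Equiv.swap i j s.2))
        (fun s _ => (Equiv.swap i j s.1, Equiv.swap i j s.2)) hmem hmem (by simp) (by simp)
        (by simp)
    nth_rewrite 2 [hS']
    exact Intertwines.prod S fun s _ => rename_intertwines_factor hinj s.1 s.2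

theorem evalAt_sub {m : ℕ} (k : Fin m → ℤ) (f g : MvPolynomial (Fin m) ℂ) :
    evalAt k (f - g) = evalAt k f - evalAt k g := map_sub _ _ _

theorem evalAt_sEinv {m : ℕ} (k : Fin m → ℤ) (i : Fin m) (f : MvPolynomial (Fin m) ℂ) :
    evalAt k ((sEinv i : Op m) f) = evalAt (Function.update k i (k i - 1)) f :=
  evalAt_E_inv k i f

theorem evalAt_rename {m n : ℕ} (g : Fin m → Fin n) (k : Fin n → ℤ)
    (f : MvPolynomial (Fin m) ℂ) : evalAt k (rename g f) = evalAt (k ∘ g) f := by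
  rw [evalAt, eval_rename]; rfl

/-- The prefactor turns `P f` into a polynomial antisymmetric in `k_i, k_j`, which vanishes where
these arguments agree. -/
theorem shiftVanishing_sProd {m : ℕ} {f : MvPolynomial (Fin m) ℂ}
    (hf : ∀ i j : Fin m, i ≠ j → rename (Equiv.swap i j) f = -f) :
    ShiftVanishing fun l => evalAt l ((sProd m : Op m) f) := by
  intro i j l hij hl
  have hne : i ≠ j := fun h => by rw [h] at hij; omega
  have h1 := swap_intertwines hij f
  rw [AlgHom.toLinearMap_apply, AlgHom.toLinearMap_apply, hf i j hne, map_neg] at h1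
  have h2 := congrArg (evalAt l) h1
  rw [evalAt_rename] at h2
  have h3 : l ∘ Equiv.swap i j = l := by
    ext r
    rw [Function.comp_apply, Equiv.swap_apply_def]
    split_ifs with h h' <;> simp [*]
  rw [h3, evalAt, map_neg, neg_eq_iff_add_eq_zero, ← evalAt, add_self_eq_zero] at h2
  rw [← h2, Subalgebra.coe_mul, Module.End.mul_apply, Subalgebra.coe_add, Subalgebra.coe_sub,
    Subalgebra.coe_mul, Subalgebra.coe_one, LinearMap.add_apply, LinearMap.sub_apply,
    Module.End.mul_apply, Module.End.one_apply]
  conv_rhs => rw [evalAt, map_add, map_sub, ← evalAt, ← evalAt, ← evalAt]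
  rw [evalAt_sEinv, evalAt_sEinv, evalAt_sEinv, Function.update_of_ne hne.symm]

theorem reflHom_intertwines_sProd (m : ℕ) (c : ℂ) :
    Intertwines (reflHom (Fin.last m) c).toLinearMap (sProd (m + 1) : Op (m + 1))
      (sProd (m + 1) : Op (m + 1)) :=
  Intertwines.prod _ fun s hs => reflHom_intertwines_factor
    (fun h => not_le.2 (Finset.mem_filter.1 hs).2 (by rw [h]; exact Fin.le_last _)) c

theorem evalAt_sProd_eq_zero {m : ℕ} {f : MvPolynomial (Fin (m + 1)) ℂ} {x : ℤ}
    (hf : reflHom (Fin.last m) (2 * x) f = -f) (l : Fin m → ℤ) :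
    evalAt (Fin.snoc l x : Fin (m + 1) → ℤ) ((sProd (m + 1) : Op (m + 1)) f) = 0 := by
  have h := reflHom_intertwines_sProd m (2 * x) f
  rw [AlgHom.toLinearMap_apply, AlgHom.toLinearMap_apply, hf, map_neg] at h
  have h2 := congrArg (evalAt (Fin.snoc l x : Fin (m + 1) → ℤ)) h
  have h3 : Function.update (fun i => ((Fin.snoc l x : Fin (m + 1) → ℤ) i : ℂ)) (Fin.last m)
      (2 * x - ((Fin.snoc l x : Fin (m + 1) → ℤ) (Fin.last m) : ℂ)) =
      fun i => ((Fin.snoc l x : Fin (m + 1) → ℤ) i : ℂ) := by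
    rw [Function.update_eq_self_iff, Fin.snoc_last]; ring
  rw [evalAt, evalAt, eval_reflHom, h3, map_neg, neg_eq_iff_add_eq_zero, add_self_eq_zero] at h2
  exact h2

theorem evalAt_prod_sEinv {m : ℕ} (S : Finset (Fin m)) (k : Fin m → ℤ)
    (f : MvPolynomial (Fin m) ℂ) :
    evalAt k ((∏ i ∈ S, sEinv i : shiftAlg m).1 f) =
      evalAt (fun i => k i - if i ∈ S then 1 else 0) f := by
  classical
  induction S using Finset.induction_on generalizing k with
  | empty => simp [Module.End.one_apply]
  | insert a S ha ih =>
    rw [Finset.prod_insert ha]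
    change evalAt k ((sEinv a : Op m) ((∏ i ∈ S, sEinv i : shiftAlg m).1 f)) = _
    rw [evalAt_sEinv, ih]
    congr 1
    ext i
    by_cases h : i = a
    · subst h; simp [ha]
    · simp [h]

/-- The pairs split into `(j, q)`, which act trivially, `(p, j)`, which contribute `E_p⁻¹`, and
pairs avoiding `j`, which reproduce `P_m`. -/
theorem rename_succAbove_intertwines_sProd {m : ℕ} (j : Fin (m + 1)) :
    Intertwines (rename j.succAbove).toLinearMap
      ((∏ p ∈ Finset.univ.filter (fun p : Fin m => p.castSucc < j), sEinv p) * sProd m : shiftAlg m)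
      (sProd (m + 1) : Op (m + 1)) := by
  have hR : Intertwines (rename j.succAbove).toLinearMap ((1 : shiftAlg m) : Op m)
      (∏ q : Fin m, if j < j.succAbove q then sFactor j (j.succAbove q) else 1 :
        shiftAlg (m + 1)) := by
    rw [show (1 : shiftAlg m) = ∏ _q : Fin m, 1 from Finset.prod_const_one.symm]
    refine Intertwines.prod _ fun q _ => ?_
    split_ifs
    · exact rename_succAbove_intertwines_factor_right j q
    · exact Intertwines.one
  have hL : Intertwines (rename j.succAbove).toLinearMap
      (∏ p ∈ Finset.univ.filter (fun p : Fin m => p.castSucc < j), sEinv p : shiftAlg m)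
      (∏ p : Fin m, if j.succAbove p < j then sFactor (j.succAbove p) j else 1 :
        shiftAlg (m + 1)) := by
    rw [Finset.prod_filter]
    refine Intertwines.prod _ fun p _ => ?_
    simp only [Fin.succAbove_lt_iff_castSucc_lt]
    split_ifs
    · exact rename_succAbove_intertwines_factor_left j p
    · exact Intertwines.one
  have hM : Intertwines (rename j.succAbove).toLinearMap (sProd m : Op m)
      (∏ p : Fin m, ∏ q : Fin m, if j.succAbove p < j.succAbove q then
        sFactor (j.succAbove p) (j.succAbove q) else 1 : shiftAlg (m + 1)) := by
    rw [sProd_eq]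
    refine Intertwines.prod _ fun p _ => Intertwines.prod _ fun q _ => ?_
    simp only [Fin.succAbove_lt_succAbove_iff]
    split_ifs
    · exact rename_intertwines_factor Fin.succAbove_right_injective p q
    · exact Intertwines.one
  have := hR.mul (hL.mul hM)
  rw [Subalgebra.coe_one, one_mul] at this
  rw [sProd_eq (m + 1), Fin.prod_univ_succAbove _ j, Fin.prod_univ_succAbove _ j]
  simp only [Fin.prod_univ_succAbove _ j, lt_irrefl, if_false, one_mul, Finset.prod_mul_distrib]
  simpa only [Subalgebra.coe_mul] using this

/-! ### The product of the backward differences -/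

/-- The backward difference of a function in one of its arguments. -/
def nablaAt {m : ℕ} (i : Fin m) (b : (Fin m → ℤ) → ℂ) (l : Fin m → ℤ) : ℂ :=
  b l - b (Function.update l i (l i - 1))

theorem foldr_nablaAt_snoc {m : ℕ} (L : List (Fin m)) (b : (Fin (m + 1) → ℤ) → ℂ) (t : ℤ)
    (l : Fin m → ℤ) :
    (L.map Fin.castSucc).foldr nablaAt b (Fin.snoc l t) =
      L.foldr nablaAt (fun l => b (Fin.snoc l t)) l := by
  induction L generalizing l with
  | nil => rfl
  | cons i L ih =>
    rw [List.map_cons, List.foldr_cons, List.foldr_cons, nablaAt, nablaAt, ← ih, ← ih,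
      Fin.snoc_castSucc, Fin.snoc_update]

theorem nablaFun_eq_foldr (m : ℕ) (b : (Fin m → ℤ) → ℂ) (l : Fin m → ℤ) :
    nablaFun m b l = (List.finRange m).foldr nablaAt b l := by
  induction m with
  | zero => rfl
  | succ m ih =>
    rw [nablaFun, ih, List.finRange_succ_last, List.foldr_append, ← Fin.snoc_init_self l,
      foldr_nablaAt_snoc]
    simp [nablaAt, Fin.update_snoc_last]

/-- The composition of all the backward differences. -/
noncomputable def sNabla (m : ℕ) : shiftAlg m :=
  ((List.finRange m).map fun i => 1 - sEinv i).prod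

theorem nablaFun_evalAt {m : ℕ} (f : MvPolynomial (Fin m) ℂ) (l : Fin m → ℤ) :
    nablaFun m (fun l => evalAt l f) l = evalAt l ((sNabla m : Op m) f) := by
  rw [nablaFun_eq_foldr, sNabla]
  generalize List.finRange m = L
  induction L generalizing l with
  | nil => rfl
  | cons i L ih =>
    rw [List.foldr_cons, nablaAt, ih, ih, List.map_cons, List.prod_cons, Subalgebra.coe_mul,
      Module.End.mul_apply, Subalgebra.coe_sub, LinearMap.sub_apply, evalAt_sub, evalAt_sEinv]
    rfl

theorem evalAt_ext {m : ℕ} {f g : MvPolynomial (Fin m) ℂ} (h : ∀ l, evalAt l f = evalAt l g) :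
    f = g := by
  refine MvPolynomial.funext_set (fun _ => Set.range ((↑) : ℤ → ℂ))
    (fun _ => Set.infinite_range_of_injective Int.cast_injective) fun x hx => ?_
  choose l hl using fun i => hx i (Set.mem_univ i)
  obtain rfl : (fun i => (l i : ℂ)) = x := funext hl
  exact h l

theorem nablaFun_sProd {m : ℕ} {f g : MvPolynomial (Fin m) ℂ}
    (h : ∀ l, nablaFun m (fun l => evalAt l f) l = evalAt l g) (l : Fin m → ℤ) :
    nablaFun m (fun l => evalAt l ((sProd m : Op m) f)) l = evalAt l ((sProd m : Op m) g) := by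
  have hg : (sNabla m : Op m) f = g := evalAt_ext fun l => by rw [← nablaFun_evalAt, h]
  rw [nablaFun_evalAt, ← Module.End.mul_apply, ← Subalgebra.coe_mul, mul_comm,
    Subalgebra.coe_mul, Module.End.mul_apply, hg]

/-! ### One step of the recursion -/

/-- The hypotheses on `f` say that `f` is antisymmetric and that `g` is its iterated backward
difference. -/
theorem sumOp_sProd {m : ℕ} {f g : MvPolynomial (Fin m) ℂ}
    (hf : ∀ i j : Fin m, i ≠ j → rename (Equiv.swap i j) f = -f)
    (hfg : ∀ l, nablaFun m (fun l => evalAt l f) l = evalAt l g)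
    (a : (Fin m → ℤ) → ℤ) (ha : ∀ l, (a l : ℂ) = evalAt l ((sProd m : Op m) g))
    (k : Fin (m + 1) → ℤ) :
    (sumOp m k a : ℂ) = altSum m k fun l => evalAt l ((sProd m : Op m) f) :=
  sumOp_eq_altSum m k a _ (shiftVanishing_sProd hf) fun l => by rw [ha, nablaFun_sProd hfg]

theorem altSum_sProd {m : ℕ} (f : MvPolynomial (Fin m) ℂ) (k : Fin (m + 1) → ℤ) :
    altSum m k (fun l => evalAt l ((sProd m : Op m) f)) = evalAt k ((sProd (m + 1) : Op (m + 1))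
      (∑ j : Fin (m + 1), (-1) ^ (j : ℕ) * rename j.succAbove f)) := by
  rw [altSum_eq_sum, map_sum, evalAt, map_sum]
  refine Finset.sum_congr rfl fun j _ => ?_
  have h : ((-1) ^ (j : ℕ) * rename j.succAbove f : MvPolynomial (Fin (m + 1)) ℂ) =
      ((-1) ^ (j : ℕ) : ℂ) • rename j.succAbove f := by
    rw [smul_eq_C_mul]; simp
  have h2 := rename_succAbove_intertwines_sProd j f
  rw [AlgHom.toLinearMap_apply, AlgHom.toLinearMap_apply] at h2
  rw [h, map_smul, smul_eval, h2, Subalgebra.coe_mul, Module.End.mul_apply, ← evalAt,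
    evalAt_rename, evalAt_prod_sEinv]
  simp

/-- Every term but the last has `x` as its last argument and vanishes by the reflection symmetry. -/
theorem altSum_sProd_snoc {m : ℕ} {f : MvPolynomial (Fin (m + 1)) ℂ} {x : ℤ}
    (hf : reflHom (Fin.last m) (2 * x) f = -f) (k : Fin (m + 1) → ℤ) :
    altSum (m + 1) (Fin.snoc k x) (fun l => evalAt l ((sProd (m + 1) : Op (m + 1)) f)) =
      (-1) ^ (m + 1) * evalAt k ((sProd (m + 1) : Op (m + 1))
        ((∏ i, sEinv i : shiftAlg (m + 1)).1 f)) := by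
  rw [altSum, Fin.snoc_last, Fin.init_snoc]
  simp only [evalAt_sProd_eq_zero hf, altSum_zero, zero_add]
  have h : (sProd (m + 1) : Op (m + 1)) ((∏ i, sEinv i : shiftAlg (m + 1)).1 f) =
      (∏ i, sEinv i : shiftAlg (m + 1)).1 ((sProd (m + 1) : Op (m + 1)) f) := by
    rw [← Module.End.mul_apply, ← Subalgebra.coe_mul, mul_comm, Subalgebra.coe_mul,
      Module.End.mul_apply]
  rw [h, evalAt_prod_sEinv]
  simp

/-! ### Factorial polynomials that are even about `1 / 2` and odd about `0` -/

/-- The monic polynomial of degree `2j` with zeros `1 - j, …, j`. -/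
def evenProd {R : Type*} [CommRing R] (j : ℕ) (u : R) : R :=
  ∏ s ∈ Finset.range j, (u * (u - 1) - (s * (s + 1) : R))

/-- The monic polynomial of degree `2j + 1` with zeros `-j, …, j`. -/
def oddProd {R : Type*} [CommRing R] (j : ℕ) (u : R) : R :=
  u * ∏ s ∈ Finset.range j, (u ^ 2 - ((s + 1) ^ 2 : R))

section Factorial

variable {R : Type*} [CommRing R] (j : ℕ) (u : R)

theorem evenProd_succ : evenProd (j + 1) u = evenProd j u * ((u - 1 - j) * (u + j)) := by
  rw [evenProd, Finset.prod_range_succ, evenProd]; ring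

theorem oddProd_succ : oddProd (j + 1) u = oddProd j u * ((u - j - 1) * (u + j + 1)) := by
  rw [oddProd, Finset.prod_range_succ, oddProd]; ring

theorem oddProd_eq : oddProd j u = evenProd j u * (u + j) := by
  induction j with
  | zero => simp [oddProd, evenProd]
  | succ j ih => rw [oddProd_succ, evenProd_succ, ih]; push_cast; ring

theorem oddProd_sub_one : oddProd j (u - 1) = evenProd j u * (u - 1 - j) := by
  induction j with
  | zero => simp [oddProd, evenProd]
  | succ j ih => rw [oddProd_succ, evenProd_succ, ih]; push_cast; ring

theorem evenProd_succ_add_one : evenProd (j + 1) (u + 1) = oddProd j u * (u + j + 1) := by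
  induction j with
  | zero => simp [oddProd, evenProd]; ring
  | succ j ih => rw [oddProd_succ, evenProd_succ, ih]; push_cast; ring

theorem evenProd_succ_sub :
    evenProd (j + 1) u - evenProd (j + 1) (u + 1) = -(2 * j + 2) * oddProd j u := by
  rw [evenProd_succ_add_one, evenProd_succ, ← mul_assoc, mul_right_comm, ← oddProd_eq]; ring

theorem oddProd_sub : oddProd j u - oddProd j (u - 1) = (2 * j + 1) * evenProd j u := by
  rw [oddProd_eq, oddProd_sub_one]; ring

theorem oddProd_neg : oddProd j (-u) = -oddProd j u := by
  rw [oddProd, oddProd, neg_sq, neg_mul]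

theorem map_evenProd {S : Type*} [CommRing S] (φ : R →+* S) :
    φ (evenProd j u) = evenProd j (φ u) := by
  simp [evenProd, map_prod]

theorem map_oddProd {S : Type*} [CommRing S] (φ : R →+* S) :
    φ (oddProd j u) = oddProd j (φ u) := by
  simp [oddProd, map_prod]

end Factorial

/-- The factor `(-1)^j / (2j)!`. -/
noncomputable def evenCoeff (j : ℕ) : ℂ := (-1) ^ j / (2 * j).factorial

/-- The factor `(-1)^j / (2j + 1)!`. -/
noncomputable def oddCoeff (j : ℕ) : ℂ := (-1) ^ j / (2 * j + 1).factorial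

theorem evenCoeff_succ (j : ℕ) : evenCoeff (j + 1) * -(2 * j + 2) = oddCoeff j := by
  have h : ((2 * j + 1).factorial : ℂ) ≠ 0 := by exact_mod_cast (Nat.factorial_pos _).ne'
  have h2 : (2 * j + 2 : ℂ) ≠ 0 := by exact_mod_cast (by omega : 2 * j + 2 ≠ 0)
  rw [evenCoeff, oddCoeff, show 2 * (j + 1) = 2 * j + 1 + 1 by ring, Nat.factorial_succ]
  push_cast
  rw [show (2 * j + 1 + 1 : ℂ) = 2 * j + 2 by ring]
  field_simp
  ring

theorem oddCoeff_mul (j : ℕ) : oddCoeff j * (2 * j + 1) = evenCoeff j := by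
  have h : ((2 * j).factorial : ℂ) ≠ 0 := by exact_mod_cast (Nat.factorial_pos _).ne'
  have h2 : (2 * j + 1 : ℂ) ≠ 0 := by exact_mod_cast (by omega : 2 * j + 1 ≠ 0)
  rw [evenCoeff, oddCoeff, Nat.factorial_succ]
  push_cast
  field_simp

/-! ### Determinants -/

/-- Up to the column factors `c j`, the columns are monic polynomials of degrees `0, 1, ...` in `w
i`, so column operations lead to the Vandermonde determinant. -/
theorem det_factorial_vandermonde {R : Type*} [CommRing R] [Nontrivial R] {m : ℕ} (c a : ℕ → R)
    (w : Fin m → R) :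
    (Matrix.of fun i j : Fin m => c j * ∏ s ∈ Finset.range j, (w i - a s)).det =
      (∏ j : Fin m, c j) * ∏ i : Fin m, ∏ j ∈ Finset.Ioi i, (w j - w i) := by
  have h := Matrix.det_eval_matrixOfPolynomials_eq_det_vandermonde w
    (fun j : Fin m => ∏ s ∈ Finset.range j, (Polynomial.X - Polynomial.C (a s)))
    (fun j => by rw [Polynomial.natDegree_finsetProd_X_sub_C_eq_card, Finset.card_range])
    (fun j => Polynomial.monic_prod_X_sub_C _ _)
  rw [Matrix.det_vandermonde] at h
  rw [h, ← Matrix.det_mul_row]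
  simp [Polynomial.eval_prod]

theorem prod_lt_eq {M : Type*} [CommMonoid M] {m : ℕ} (f : Fin m → Fin m → M) :
    ∏ s ∈ Finset.univ.filter (fun s : Fin m × Fin m => s.1 < s.2), f s.1 s.2 =
      ∏ i : Fin m, ∏ j ∈ Finset.Ioi i, f i j := by
  rw [Finset.prod_filter, Fintype.prod_prod_type]
  refine Finset.prod_congr rfl fun i _ => ?_
  rw [← Finset.prod_filter]
  congr 1
  ext; simp

theorem prod_lt_eq_range {M : Type*} [CommMonoid M] {m : ℕ} (f : ℕ → ℕ → M) :
    ∏ s ∈ Finset.univ.filter (fun s : Fin m × Fin m => s.1 < s.2), f s.1 s.2 =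
      ∏ j : Fin m, ∏ i ∈ Finset.range j, f i j := by
  rw [Finset.prod_filter, Fintype.prod_prod_type, Finset.prod_comm]
  refine Finset.prod_congr rfl fun j _ => ?_
  rw [← Finset.prod_filter, ← Nat.Iio_eq_range, ← Fin.map_valEmbedding_Iio, Finset.prod_map]
  refine Finset.prod_congr ?_ fun i _ => rfl
  ext; simp

/-- The extra parameter `n` is for the induction; the case `n = j` gives the denominator `(2j)!`. -/
theorem prod_range_odd (j n : ℕ) (h : n ≤ j) :
    (∏ i ∈ Finset.range n, (((j : ℂ) - i) * (j + i + 1))) * (j - n).factorial =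
      (j + n).factorial := by
  induction n with
  | zero => simp
  | succ n ih =>
    rw [Finset.prod_range_succ, ← add_assoc, Nat.factorial_succ, Nat.cast_mul, ← ih (by omega),
      show j - n = j - (n + 1) + 1 by omega, Nat.factorial_succ, show j - (n + 1) + 1 = j - n by omega]
    push_cast [Nat.cast_sub (show n ≤ j by omega)]
    ring

theorem prod_range_even (j n : ℕ) (h : n ≤ j) :
    (∏ i ∈ Finset.range n, (((j : ℂ) - i) * (j + i + 2))) * ((j - n).factorial * (j + 1)) =
      (j + n + 1).factorial := by
  induction n with
  | zero => rw [add_zero, Nat.factorial_succ]; push_cast; simp; ring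
  | succ n ih =>
    rw [Finset.prod_range_succ, show j + (n + 1) + 1 = j + n + 1 + 1 by ring,
      Nat.factorial_succ (j + n + 1), Nat.cast_mul, ← ih (by omega),
      show j - n = j - (n + 1) + 1 by omega, Nat.factorial_succ, show j - (n + 1) + 1 = j - n by omega]
    push_cast [Nat.cast_sub (show n ≤ j by omega)]
    ring

theorem prod_odd_denominators (j : ℕ) :
    ∏ i ∈ Finset.range j, (-(1 / (((j : ℂ) + 1 - (i + 1)) * (j + 1 + (i + 1) - 1)))) =
      evenCoeff j := by
  have h := prod_range_odd j j le_rfl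
  rw [Nat.sub_self, Nat.factorial_zero, Nat.cast_one, mul_one] at h
  rw [evenCoeff, two_mul, ← h]
  simp only [← neg_div]
  rw [Finset.prod_div_distrib, Finset.prod_const, Finset.card_range]
  congr 1
  refine Finset.prod_congr rfl fun i _ => by ring

theorem prod_even_denominators (j : ℕ) :
    (∏ i ∈ Finset.range j, (-(1 / (((j : ℂ) + 1 - (i + 1)) * (j + 1 + (i + 1)))))) *
      (1 / (j + 1)) = oddCoeff j := by
  have h := prod_range_even j j le_rfl
  rw [Nat.sub_self, Nat.factorial_zero, Nat.cast_one, one_mul] at h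
  rw [oddCoeff, two_mul, ← h, ← div_div, div_eq_mul_one_div (_ / _) ((j : ℂ) + 1)]
  congr 1
  simp only [← neg_div]
  rw [Finset.prod_div_distrib, Finset.prod_const, Finset.card_range]
  congr 1
  refine Finset.prod_congr rfl fun i _ => by ring

/-- The polynomial `x + 1 - k_i`. -/
noncomputable def uPoly {m : ℕ} (x : ℤ) (i : Fin m) : MvPolynomial (Fin m) ℂ :=
  C ((x : ℂ) + 1) - X i

/-- `evenProd j u` is monic of degree `j` in `u (u - 1)`, and the differences of `u (u - 1)` are
`(k_i - k_j) (2x + 1 - k_i - k_j)`. The reversed sign of `k_j - k_i` accounts for `(-1)^j` in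
`evenCoeff`. -/
theorem polyOdd_eq_det (m : ℕ) (x : ℤ) : polyOdd m x =
    (Matrix.of fun i j : Fin m => C (evenCoeff j) * evenProd j (uPoly x i)).det := by
  simp only [evenProd]
  rw [det_factorial_vandermonde (fun j => C (evenCoeff j))
    (fun s => (s * (s + 1) : MvPolynomial (Fin m) ℂ)) (fun i => uPoly x i * (uPoly x i - 1)),
    ← prod_lt_eq (fun i j => uPoly x j * (uPoly x j - 1) - uPoly x i * (uPoly x i - 1))]
  simp only [← prod_odd_denominators, map_prod]
  rw [← prod_lt_eq_range (fun i j => (C (-(1 / (((j : ℂ) + 1 - (i + 1)) *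
    (j + 1 + (i + 1) - 1)))) : MvPolynomial (Fin m) ℂ)), ← Finset.prod_mul_distrib, polyOdd]
  refine Finset.prod_congr rfl fun s _ => ?_
  simp only [idx, map_neg, uPoly]
  rw [show (2 * (x : ℂ) + 1) = (x + 1) + (x + 1) - 1 by ring, map_sub, map_add, map_one]
  ring

/-- After `u` is pulled out of each row, `oddProd` leaves a monic polynomial in `u²`, whose
differences are `(k_i - k_j) (2x + 2 - k_i - k_j)`. -/
theorem polyEven_eq_det (m : ℕ) (x : ℤ) : polyEven m x =
    (Matrix.of fun i j : Fin m => C (oddCoeff j) * oddProd j (uPoly x i)).det := by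
  have h : (Matrix.of fun i j : Fin m => C (oddCoeff j) * oddProd j (uPoly x i)) =
      Matrix.of fun i j : Fin m => uPoly x i * (Matrix.of fun i j : Fin m => C (oddCoeff j) *
        ∏ s ∈ Finset.range j, (uPoly x i ^ 2 - ((s + 1) ^ 2 : MvPolynomial (Fin m) ℂ))) i j := by
    ext1 i j
    simp only [Matrix.of_apply, oddProd]
    ring
  rw [h, Matrix.det_mul_column, det_factorial_vandermonde (fun j => C (oddCoeff j))
    (fun s => ((s + 1) ^ 2 : MvPolynomial (Fin m) ℂ)) (fun i => uPoly x i ^ 2),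
    ← prod_lt_eq (fun i j => uPoly x j ^ 2 - uPoly x i ^ 2)]
  simp only [← prod_even_denominators, map_prod, map_mul, Finset.prod_mul_distrib]
  rw [← prod_lt_eq_range (fun i j => (C (-(1 / (((j : ℂ) + 1 - (i + 1)) *
    (j + 1 + (i + 1))))) : MvPolynomial (Fin m) ℂ)), polyEven]
  have hp : ∏ s ∈ Finset.univ.filter (fun s : Fin m × Fin m => s.1 < s.2),
      (C (1 / ((idx s.2 - idx s.1) * (idx s.2 + idx s.1))) *
        ((X s.2 - X s.1) * (C (2 * (x : ℂ) + 2) - X s.1 - X s.2)) : MvPolynomial (Fin m) ℂ) =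
      (∏ s ∈ Finset.univ.filter (fun s : Fin m × Fin m => s.1 < s.2),
        C (-(1 / ((((s.2 : ℕ) : ℂ) + 1 - ((s.1 : ℕ) + 1)) * ((s.2 : ℕ) + 1 + ((s.1 : ℕ) + 1)))))) *
      ∏ s ∈ Finset.univ.filter (fun s : Fin m × Fin m => s.1 < s.2),
        (uPoly x s.2 ^ 2 - uPoly x s.1 ^ 2) := by
    rw [← Finset.prod_mul_distrib]
    refine Finset.prod_congr rfl fun s _ => ?_
    simp only [idx, map_neg, uPoly]
    rw [show (2 * (x : ℂ) + 2) = (x + 1) + (x + 1) by ring, map_add]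
    ring
  rw [hp, Finset.prod_mul_distrib]
  simp only [idx, uPoly]
  ring

/-! ### Determinants under evaluation, permutation of variables and differencing -/

theorem evalAt_det {m n : ℕ} (l : Fin m → ℤ) (M : Matrix (Fin n) (Fin n) (MvPolynomial (Fin m) ℂ)) :
    evalAt l M.det = (Matrix.of fun i j => evalAt l (M i j)).det :=
  RingHom.map_det _ _

theorem rename_swap_det {m : ℕ} {M : Matrix (Fin m) (Fin m) (MvPolynomial (Fin m) ℂ)}
    (hM : ∀ (σ : Equiv.Perm (Fin m)) i j, rename σ (M i j) = M (σ i) j) (i j : Fin m)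
    (hij : i ≠ j) : rename (Equiv.swap i j) M.det = -M.det := by
  rw [AlgHom.map_det]
  have : (rename (Equiv.swap i j)).mapMatrix M = M.submatrix (Equiv.swap i j) id := by
    ext1 a b; exact hM _ a b
  rw [this, Matrix.det_permute, Equiv.Perm.sign_swap hij]
  simp

/-- Row `i` involves only the variable `k_i`, so in each Leibniz term the iterated difference acts
factor by factor. -/
theorem nablaFun_det {m : ℕ} {M M' : Matrix (Fin m) (Fin m) (MvPolynomial (Fin m) ℂ)}
    (φ : Fin m → ℤ → ℂ) (hM : ∀ l i j, evalAt l (M i j) = φ j (l i))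
    (hM' : ∀ l i j, evalAt l (M' i j) = φ j (l i) - φ j (l i - 1)) (l : Fin m → ℤ) :
    nablaFun m (fun l => evalAt l M.det) l = evalAt l M'.det := by
  simp only [evalAt_det, hM, hM']
  have h (A : Fin m → Fin m → ℂ) : (Matrix.of A).det =
      ∑ σ : Equiv.Perm (Fin m), ((Equiv.Perm.sign σ : ℤ) : ℂ) * ∏ i, A i (σ i) := by
    rw [← Matrix.det_transpose, Matrix.det_apply']; rfl
  simp only [h]
  rw [nablaFun_sum Finset.univ m (fun σ : Equiv.Perm (Fin m) => ((Equiv.Perm.sign σ : ℤ) : ℂ))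
    (fun σ l => ∏ i, φ (σ i) (l i))]
  exact Finset.sum_congr rfl fun σ _ => by rw [nablaFun_prod m (fun i => φ (σ i))]

theorem evalAt_C_mul {m : ℕ} (l : Fin m → ℤ) (c : ℂ) (f : MvPolynomial (Fin m) ℂ) :
    evalAt l (C c * f) = c * evalAt l f := by
  simp [evalAt]

theorem evalAt_uPoly {m : ℕ} (l : Fin m → ℤ) (x : ℤ) (i : Fin m) :
    evalAt l (uPoly x i) = x + 1 - l i := by
  simp [evalAt, uPoly]

theorem evalAt_evenProd {m : ℕ} (l : Fin m → ℤ) (j : ℕ) (f : MvPolynomial (Fin m) ℂ) :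
    evalAt l (evenProd j f) = evenProd j (evalAt l f) := map_evenProd j f _

theorem evalAt_oddProd {m : ℕ} (l : Fin m → ℤ) (j : ℕ) (f : MvPolynomial (Fin m) ℂ) :
    evalAt l (oddProd j f) = oddProd j (evalAt l f) := map_oddProd j f _

theorem rename_uPoly {m n : ℕ} (g : Fin m → Fin n) (x : ℤ) (i : Fin m) :
    rename g (uPoly x i) = uPoly x (g i) := by
  simp [uPoly]

theorem rename_C_mul_evenProd {m n : ℕ} (g : Fin m → Fin n) (c : ℂ) (j : ℕ)
    (f : MvPolynomial (Fin m) ℂ) :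
    rename g (C c * evenProd j f) = C c * evenProd j (rename g f) := by
  rw [map_mul, rename_C]
  exact congrArg _ (map_evenProd j f (rename g : MvPolynomial (Fin m) ℂ →ₐ[ℂ] _).toRingHom)

theorem rename_C_mul_oddProd {m n : ℕ} (g : Fin m → Fin n) (c : ℂ) (j : ℕ)
    (f : MvPolynomial (Fin m) ℂ) :
    rename g (C c * oddProd j f) = C c * oddProd j (rename g f) := by
  rw [map_mul, rename_C]
  exact congrArg _ (map_oddProd j f (rename g : MvPolynomial (Fin m) ℂ →ₐ[ℂ] _).toRingHom)

/-! ### Antidifferences of the explicit polynomials -/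

/-- The matrix whose determinant is an antisymmetric antidifference of `polyEven`. -/
noncomputable def antiEven (m : ℕ) (x : ℤ) : Matrix (Fin m) (Fin m) (MvPolynomial (Fin m) ℂ) :=
  Matrix.of fun i j => C (evenCoeff (j + 1)) * evenProd (j + 1) (uPoly x i)

/-- The matrix whose determinant is an antisymmetric antidifference of `polyOdd` that is odd
under the reflections `k_i ↦ 2x - k_i`. -/
noncomputable def antiOdd (m : ℕ) (x : ℤ) : Matrix (Fin m) (Fin m) (MvPolynomial (Fin m) ℂ) :=
  Matrix.of fun i j => C (-oddCoeff j) * oddProd j (uPoly x i - 1)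

theorem rename_antiEven (m : ℕ) (x : ℤ) (σ : Equiv.Perm (Fin m)) (i j : Fin m) :
    rename σ (antiEven m x i j) = antiEven m x (σ i) j := by
  rw [antiEven, Matrix.of_apply, rename_C_mul_evenProd, rename_uPoly, Matrix.of_apply]

theorem rename_antiOdd (m : ℕ) (x : ℤ) (σ : Equiv.Perm (Fin m)) (i j : Fin m) :
    rename σ (antiOdd m x i j) = antiOdd m x (σ i) j := by
  rw [antiOdd, Matrix.of_apply, rename_C_mul_oddProd, map_sub, map_one, rename_uPoly,
    Matrix.of_apply]

theorem nablaFun_antiEven (m : ℕ) (x : ℤ) (l : Fin m → ℤ) :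
    nablaFun m (fun l => evalAt l (antiEven m x).det) l = evalAt l (polyEven m x) := by
  rw [polyEven_eq_det]
  refine nablaFun_det (fun j t => evenCoeff (j + 1) * evenProd (j + 1) ((x : ℂ) + 1 - t)) ?_ ?_ l
  · intro l i j
    rw [antiEven, Matrix.of_apply, evalAt_C_mul, evalAt_evenProd, evalAt_uPoly]
  · intro l i j
    rw [Matrix.of_apply, evalAt_C_mul, evalAt_oddProd, evalAt_uPoly, Int.cast_sub, Int.cast_one,
      -- A backward step in `k` is a forward step in `u = x + 1 - k`.
      show (x : ℂ) + 1 - (l i - 1) = x + 1 - l i + 1 by ring, ← mul_sub, evenProd_succ_sub,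
      ← mul_assoc, evenCoeff_succ]

theorem nablaFun_antiOdd (m : ℕ) (x : ℤ) (l : Fin m → ℤ) :
    nablaFun m (fun l => evalAt l (antiOdd m x).det) l = evalAt l (polyOdd m x) := by
  rw [polyOdd_eq_det]
  refine nablaFun_det (fun j t => -oddCoeff j * oddProd j ((x : ℂ) + 1 - t - 1)) ?_ ?_ l
  · intro l i j
    rw [antiOdd, Matrix.of_apply, evalAt_C_mul, evalAt_oddProd, evalAt_sub, evalAt_uPoly]
    simp [evalAt]
  · intro l i j
    rw [Matrix.of_apply, evalAt_C_mul, evalAt_evenProd, evalAt_uPoly, Int.cast_sub, Int.cast_one,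
      show (x : ℂ) + 1 - (l i - 1) - 1 = x + 1 - l i by ring, ← oddCoeff_mul, mul_assoc,
      ← oddProd_sub]
    ring

/-- `antiEven` consists of the columns of the `polyOdd` matrix beyond the first; that first column
is constantly `1`, so this is the Laplace expansion along it. -/
theorem sum_rename_antiEven (m : ℕ) (x : ℤ) :
    ∑ j : Fin (m + 1), (-1) ^ (j : ℕ) * rename j.succAbove (antiEven m x).det =
      polyOdd (m + 1) x := by
  rw [polyOdd_eq_det, Matrix.det_succ_column_zero]
  refine Finset.sum_congr rfl fun j _ => ?_
  rw [AlgHom.map_det]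
  have h0 : (Matrix.of fun i j : Fin (m + 1) => C (evenCoeff j) * evenProd j (uPoly x i)) j 0 =
      1 := by
    simp [evenCoeff, evenProd]
  rw [h0, mul_one]
  congr 2
  ext1 a b
  rw [AlgHom.mapMatrix_apply, Matrix.map_apply, antiEven, Matrix.of_apply, rename_C_mul_evenProd,
    rename_uPoly]
  rfl

/-- The argument `u - 1 = x - k` changes sign under `k ↦ 2x - k`, and `oddProd` is odd; only the
last row is affected. -/
theorem reflHom_antiOdd (m : ℕ) (x : ℤ) :
    reflHom (Fin.last m) (2 * x) (antiOdd (m + 1) x).det = -(antiOdd (m + 1) x).det := by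
  rw [AlgHom.map_det]
  have h : (reflHom (Fin.last m) (2 * x)).mapMatrix (antiOdd (m + 1) x) =
      Matrix.of fun i j => (if i = Fin.last m then -1 else 1) * antiOdd (m + 1) x i j := by
    ext1 i j
    rw [AlgHom.mapMatrix_apply, Matrix.map_apply, antiOdd, Matrix.of_apply, Matrix.of_apply,
      Matrix.of_apply, map_mul, algHom_C, algebraMap_eq]
    have hm : reflHom (Fin.last m) (2 * x) (oddProd j (uPoly x i - 1)) =
        oddProd j (reflHom (Fin.last m) (2 * x) (uPoly x i - 1)) :=
      map_oddProd _ _ (reflHom (Fin.last m) (2 * (x : ℂ))).toRingHom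
    rw [hm]
    split_ifs with hi
    · subst hi
      have : reflHom (Fin.last m) (2 * x) (uPoly x (Fin.last m) - 1) =
          -(uPoly x (Fin.last m) - 1) := by
        rw [uPoly, map_sub, map_sub, reflHom_X_self, algHom_C, algebraMap_eq, map_one, two_mul,
          map_add, map_add, map_one]
        ring
      rw [this, oddProd_neg]
      ring
    · rw [uPoly, map_sub, map_sub, reflHom_X_of_ne hi, algHom_C, algebraMap_eq, map_one, one_mul]
  rw [h, Matrix.det_mul_column, Finset.prod_ite_eq' Finset.univ (Fin.last m) fun _ => -1]
  simp

/-- Shifting every `k_i` down by one turns `u - 1` into `u`; the sign comes from `-oddCoeff` in each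
of the `m` columns, and it cancels the sign of the surviving term of the alternating sum. -/
theorem sEinv_antiOdd (m : ℕ) (x : ℤ) :
    (∏ i, sEinv i : shiftAlg m).1 (antiOdd m x).det = (-1) ^ m * polyEven m x := by
  refine evalAt_ext fun l => ?_
  rw [evalAt_prod_sEinv, evalAt_det, evalAt, map_mul, ← evalAt, ← evalAt, polyEven_eq_det,
    evalAt_det]
  have h : evalAt l ((-1) ^ m) = (-1) ^ Fintype.card (Fin m) := by simp [evalAt]
  rw [h, ← Matrix.det_neg]
  congr 1
  ext1 i j
  rw [Matrix.neg_apply, Matrix.of_apply, Matrix.of_apply, Matrix.of_apply, antiOdd,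
    Matrix.of_apply, evalAt_C_mul, evalAt_C_mul, evalAt_oddProd, evalAt_oddProd, evalAt_sub,
    evalAt_uPoly, evalAt_uPoly, neg_mul]
  congr 3
  simp [evalAt]
  ring

/-! ### The operator formulas -/

theorem gammaOdd_eq_of_gammaEven {m : ℕ} {x : ℤ}
    (h : ∀ l, (gammaEven x m l : ℂ) = evalAt l ((sProd m : Op m) (polyEven m x)))
    (k : Fin (m + 1) → ℤ) :
    (gammaOdd x m k : ℂ) = evalAt k ((sProd (m + 1) : Op (m + 1)) (polyOdd (m + 1) x)) := by
  rw [gammaOdd, sumOp_sProd (rename_swap_det (rename_antiEven m x)) (nablaFun_antiEven m x) _ h,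
    altSum_sProd, sum_rename_antiEven]

theorem gammaEven_succ_eq_of_gammaOdd {m : ℕ} {x : ℤ}
    (h : ∀ l, (gammaOdd x m l : ℂ) = evalAt l ((sProd (m + 1) : Op (m + 1)) (polyOdd (m + 1) x)))
    (k : Fin (m + 1) → ℤ) :
    (gammaEven x (m + 1) k : ℂ) =
      evalAt k ((sProd (m + 1) : Op (m + 1)) (polyEven (m + 1) x)) := by
  rw [gammaEven_succ, sumOp_sProd (rename_swap_det (rename_antiOdd (m + 1) x))
    (nablaFun_antiOdd (m + 1) x) _ h, altSum_sProd_snoc (reflHom_antiOdd m x), sEinv_antiOdd]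
  have h1 : ((-1) ^ (m + 1) * polyEven (m + 1) x : MvPolynomial (Fin (m + 1)) ℂ) =
      ((-1) ^ (m + 1) : ℂ) • polyEven (m + 1) x := by
    rw [smul_eq_C_mul]; simp
  rw [h1, map_smul, evalAt, smul_eval, ← mul_assoc, ← mul_pow]
  simp [evalAt]

theorem gammaEven_eq (m : ℕ) (x : ℤ) (k : Fin m → ℤ) :
    (gammaEven x m k : ℂ) = evalAt k (prodOp m (polyEven m x)) := by
  rw [← coe_sProd]
  induction m with
  | zero => simp [gammaEven, polyEven, sProd, evalAt, Module.End.one_apply]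
  | succ m ih => exact gammaEven_succ_eq_of_gammaOdd (gammaOdd_eq_of_gammaEven ih) k

theorem gammaOdd_eq (m : ℕ) (x : ℤ) (k : Fin (m + 1) → ℤ) :
    (gammaOdd x m k : ℂ) = evalAt k (prodOp (m + 1) (polyOdd (m + 1) x)) := by
  rw [← coe_sProd]
  exact gammaOdd_eq_of_gammaEven (fun l => by rw [gammaEven_eq, ← coe_sProd]) k

end HalvedMonotone

theorem theorem2 :
    -- all the inverses that occur exist
    (∀ (m : ℕ) (p q : Fin m), p < q →
      IsUnit (HalvedMonotone.opA p q) ∧ IsUnit (HalvedMonotone.opB p q)) ∧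
    -- `n = 2 * m + 1` odd, with `(n + 1) / 2 = m + 1` variables
    (∀ (m : ℕ) (x : ℤ) (k : Fin (m + 1) → ℤ),
      (HalvedMonotone.gammaOdd x m k : ℂ) =
          HalvedMonotone.evalAt k
            (HalvedMonotone.prodOp (m + 1) (HalvedMonotone.polyOdd (m + 1) x)) ∧
      (StrictMono k → (∀ i, k i ≤ x) →
        (HalvedMonotone.triangles (2 * m + 1) x k).Finite ∧
        ((HalvedMonotone.triangles (2 * m + 1) x k).ncard : ℂ) =
          HalvedMonotone.evalAt k
            (HalvedMonotone.prodOp (m + 1) (HalvedMonotone.polyOdd (m + 1) x)))) ∧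
    -- `n = 2 * m` even, with `n / 2 = m` variables
    (∀ (m : ℕ) (x : ℤ) (k : Fin m → ℤ),
      (HalvedMonotone.gammaEven x m k : ℂ) =
          HalvedMonotone.evalAt k
            (HalvedMonotone.prodOp m (HalvedMonotone.polyEven m x)) ∧
      (StrictMono k → (∀ i, k i ≤ x) →
        (HalvedMonotone.triangles (2 * m) x k).Finite ∧
        ((HalvedMonotone.triangles (2 * m) x k).ncard : ℂ) =
          HalvedMonotone.evalAt k
            (HalvedMonotone.prodOp m (HalvedMonotone.polyEven m x)))) := by
  refine ⟨fun m p q _ => ⟨HalvedMonotone.isUnit_opA p q, HalvedMonotone.isUnit_opB p q⟩,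
    fun m x k => ⟨HalvedMonotone.gammaOdd_eq m x k, fun hk hx => ?_⟩,
    fun m x k => ⟨HalvedMonotone.gammaEven_eq m x k, fun hk hx => ?_⟩⟩
  · obtain ⟨hfin, hcard⟩ := HalvedMonotone.gammaOdd_eq_ncard m x k hk hx
    exact ⟨hfin, by rw [← HalvedMonotone.gammaOdd_eq, ← hcard, Int.cast_natCast]⟩
  · obtain ⟨hfin, hcard⟩ := HalvedMonotone.gammaEven_eq_ncard m x k hk hx
    exact ⟨hfin, by rw [← HalvedMonotone.gammaEven_eq, ← hcard, Int.cast_natCast]⟩
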